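/- Let $K\ge 1$. For $1\le k\le K$ let $h_k,g_k$ be probability densities with respect to a $\sigma$-finite measure $\lambda_k$, with Kullback–Leibler number $I_k=\int \log(g_k/h_k)\,g_k\,d\lambda_k\in(0,\infty)$. Sensor $k$ observes $X_1^k,X_2^k,\dots$; all the variables $X_t^k$ are independent (over time and across sensors). Under $P_\infty$ every $X_t^k$ has density $h_k$. For a nonempty $A\subset\{1,\dots,K\}$ and $\nu\in\{0,1,2,\dots\}$, under $P_\nu^A$ the variable $X_t^k$ has density $g_k$ if $t>\nu$ and $k\in A$, and density $h_k$ otherwise. Let $\mathcal F_t=\sigma(X_s^k:\ 1\le s\le t,\ 1\le k\le K)$, let $\overline{\mathcal P}_K$ be the class of all nonempty subsets of $\{1,\dots,K\}$, and let $$\ell_t^k=\log\frac{g_k}{h_k}(X_t^k),\qquad Z_t^k=\sum_{r=1}^t\ell_r^k,\qquad Z_0^k=0,\qquad \ell_t^A=\sum_{k\in A}\ell_t^k .$$ For an $\{\mathcal F_t\}$-stopping time $T$ (possibly infinite) put $$\mathcal J_A[T]=\sup_{\nu\ge 0}\ \operatorname{ess\,sup}\ E_\nu^A[(T-\nu)^+\mid\mathcal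 F_\nu],\qquad \mathcal C_\gamma=\{T:\ E_\infty[T]\ge\gamma\}\quad(\gamma\ge 1).$$ A detection rule, that is a family of stopping times $T_\gamma$ ($\gamma\ge1$) with $T_\gamma\in\mathcal C_\gamma$ for every $\gamma\ge 1$, is second-order asymptotically optimal with respect to $\overline{\mathcal P}_K$ if for every $A\in\overline{\mathcal P}_K$ the difference $\mathcal J_A[T_\gamma]-\inf_{T\in\mathcal C_\gamma}\mathcal J_A[T]$ is bounded as $\gamma\to\infty$ (both terms being finite for all large $\gamma$). Consider, with $\inf\emptyset=\infty$, $$\hat S_b(\pi)=\inf\Bigl\{t\ge 1:\ \max_{0\le s\le t}\ \prod_{k=1}^K\bigl[1-\pi+\pi\exp(Z_t^k-Z_s^k)\bigr]\ge e^b\Bigr\},$$ $$\check S_b(\pi)=\inf\Bigl\{t\ge 1:\ \max_{0\le s\le t}\ \sum_{k=1}^K\log\bigl(1-\pi+\pi\exp\{(Z_t^k-Z_s^k)^+\}\bigr)\ge b\Bigr\},$$ where $Z_t^k-Z_s^k$ is read as $\sum_{s<r\le t}\ell_r^k$. Then: (i) For every $\gamma\ge 1$: $\hat S_b(\pi)\in\mathcal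 C_\gamma$ for every $\pi\in(0,1)$ if $b=\log\gamma$, and $\check S_b(\pi)\in\mathcal C_\gamma$ for every $\pi\in(0,1]$ if $b=\log\gamma+\log|\overline{\mathcal P}_K|$. (ii) If in addition $\ell_1^A$ is square-integrable under $P_0^A$ for every $A\in\overline{\mathcal P}_K$, then, with these choices of $b=b(\gamma)$, the rule $\hat S_b(\pi)$ for every $\pi\in(0,1)$ and the rule $\check S_b(\pi)$ for every $\pi\in(0,1]$ are second-order asymptotically optimal with respect to $\overline{\mathcal P}_K$. -/

import Mathlib

open MeasureTheory ProbabilityTheory Filter Asymptotics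
open scoped ENNReal Topology

/-- `K` sensors. Sensor `k` observes values in `E k` and has a pre-change density `h k` and a
post-change density `g k` with respect to a `σ`-finite measure `ref k`. -/
structure SensorModel {K : ℕ} (E : Fin K → Type*) [∀ k, MeasurableSpace (E k)] where
  /-- the dominating measure of sensor `k` -/
  ref : ∀ k, Measure (E k)
  sigmaFinite_ref : ∀ k, SigmaFinite (ref k)
  /-- the pre-change density of sensor `k` -/
  h : ∀ k, E k → ℝ≥0∞
  /-- the post-change density of sensor `k` -/
  g : ∀ k, E k → ℝ≥0∞
  measurable_h : ∀ k, Measurable (h k)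
  measurable_g : ∀ k, Measurable (g k)
  lintegral_h : ∀ k, ∫⁻ x, h k x ∂(ref k) = 1
  lintegral_g : ∀ k, ∫⁻ x, g k x ∂(ref k) = 1

namespace SensorModel

noncomputable section

/-- Sample space of all observations. The index `u : ℕ` starts at `0`, so `ω u k` is the
observation `X_{u+1}^k` of sensor `k` at time `u + 1`. -/
abbrev Path {K : ℕ} (E : Fin K → Type*) : Type _ := ℕ → ∀ k, E k

variable {K : ℕ} {E : Fin K → Type*} [∀ k, MeasurableSpace (E k)]

/-- `F_t = σ(X_1, …, X_t)`, the `σ`-algebra generated by the coordinates `u < t`. -/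
def obsFiltration (E : Fin K → Type*) [∀ k, MeasurableSpace (E k)] :
    Filtration ℕ (inferInstance : MeasurableSpace (Path E)) where
  seq t := cylinderEvents (Set.Iio t)
  mono' _ _ hst := cylinderEvents_mono (Set.Iio_subset_Iio hst)
  le' _ := cylinderEvents_le_pi

/-- The class of nonempty subsets of sensors with at most `L` elements. -/
def subsetsAtMost (K L : ℕ) : Finset (Finset (Fin K)) :=
  Finset.univ.filter fun A => 1 ≤ A.card ∧ A.card ≤ L

variable (M : SensorModel E)

/-- Pre-change distribution of sensor `k`. -/
def preLaw (k : Fin K) : Measure (E k) := (M.ref k).withDensity (M.h k)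

/-- Post-change distribution of sensor `k`. -/
def postLaw (k : Fin K) : Measure (E k) := (M.ref k).withDensity (M.g k)

instance (k : Fin K) : IsProbabilityMeasure (M.preLaw k) :=
  ⟨by simp [preLaw, M.lintegral_h]⟩

instance (k : Fin K) : IsProbabilityMeasure (M.postLaw k) :=
  ⟨by simp [postLaw, M.lintegral_g]⟩

/-- Distribution of sensor `k` at a time at which exactly the sensors in `B` are in the
post-change regime. -/
def sensorLaw (B : Finset (Fin K)) (k : Fin K) : Measure (E k) :=
  if k ∈ B then M.postLaw k else M.preLaw k

instance (B : Finset (Fin K)) (k : Fin K) : IsProbabilityMeasure (M.sensorLaw B k) := by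
  unfold sensorLaw; split_ifs <;> infer_instance

/-- Distribution of the vector of all (independent) sensors at a time at which exactly the
sensors in `B` are in the post-change regime. -/
def stepLaw (B : Finset (Fin K)) : Measure (∀ k, E k) := Measure.pi (M.sensorLaw B)

instance (B : Finset (Fin K)) : IsProbabilityMeasure (M.stepLaw B) := by
  unfold stepLaw; infer_instance

/-- `P_∞`: the change never occurs. -/
def probInf : Measure (Path E) := Measure.infinitePi fun _ : ℕ => M.stepLaw ∅

/-- `P_ν^A`: the change occurs at time `ν` in the sensors of `A`, so that `X_t` is post-change
for `t > ν`, that is, the coordinate `u = t - 1` is post-change for `ν ≤ u`. -/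
def probChange (A : Finset (Fin K)) (ν : ℕ) : Measure (Path E) :=
  Measure.infinitePi fun u : ℕ => M.stepLaw (if ν ≤ u then A else ∅)

/-- The Kullback-Leibler information number `I_k = ∫ log (g_k / h_k) g_k dλ_k`. -/
def localKL (k : Fin K) : ℝ≥0∞ := InformationTheory.klDiv (M.postLaw k) (M.preLaw k)

/-- The log-likelihood ratio `log (g_k / h_k)` as an extended real number. -/
def localLLR (k : Fin K) (x : E k) : EReal := ENNReal.log (M.g k x / M.h k x)

/-- `Z_t^k - Z_s^k = ∑_{s < r ≤ t} ℓ_r^k`, where `ℓ_r^k = log (g_k / h_k) (X_r^k)`. -/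
def incr (s t : ℕ) (k : Fin K) (ω : Path E) : EReal :=
  ∑ u ∈ Finset.Ico s t, M.localLLR k (ω u k)

/-- `ℓ_1^A = ∑_{k ∈ A} ℓ_1^k`. Infinite values, which have probability zero under `P_0^A` when the
numbers `I_k` are finite, are replaced by `0`. -/
def firstLLR (A : Finset (Fin K)) (ω : Path E) : ℝ :=
  (∑ k ∈ A, M.localLLR k (ω 0 k)).toReal

/-- `max_{0 ≤ s ≤ t} ∏_k [1 - π + π exp (Z_t^k - Z_s^k)]`. -/
def hatStat (p : ℝ) (t : ℕ) (ω : Path E) : ℝ≥0∞ :=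
  (Finset.range (t + 1)).sup fun s =>
    ∏ k, (ENNReal.ofReal (1 - p) + ENNReal.ofReal p * EReal.exp (M.incr s t k ω))

/-- The mixture rule `inf {t ≥ 1 : hatStat ≥ exp b}`, with `inf ∅ = ∞`. -/
def hatRule (p b : ℝ) (ω : Path E) : ℕ∞ :=
  ⨅ (t : ℕ) (_ : 1 ≤ t ∧ ENNReal.ofReal (Real.exp b) ≤ M.hatStat p t ω), (t : ℕ∞)

/-- `max_{0 ≤ s ≤ t} ∑_k log (1 - π + π exp {(Z_t^k - Z_s^k)^+})`. -/
def checkStat (p : ℝ) (t : ℕ) (ω : Path E) : EReal :=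
  (Finset.range (t + 1)).sup fun s =>
    ∑ k, ENNReal.log
      (ENNReal.ofReal (1 - p) + ENNReal.ofReal p * EReal.exp (max (M.incr s t k ω) 0))

/-- The Xie-Siegmund rule `inf {t ≥ 1 : checkStat ≥ b}`, with `inf ∅ = ∞`. -/
def checkRule (p b : ℝ) (ω : Path E) : ℕ∞ :=
  ⨅ (t : ℕ) (_ : 1 ≤ t ∧ (b : EReal) ≤ M.checkStat p t ω), (t : ℕ∞)

/-- The class `C_γ` of stopping times `T` (possibly infinite) with `E_∞[T] ≥ γ`. -/
def rulesClass (γ : ℝ) : Set (Path E → ℕ∞) :=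
  {T | IsStoppingTime (obsFiltration E) T ∧
    ENNReal.ofReal γ ≤ ∫⁻ ω, (T ω : ℝ≥0∞) ∂M.probInf}

/-- Lorden's criterion `J_A[T] = sup_ν ess sup E_ν^A[(T - ν)^+ | F_ν]`
(the subtraction in `ℝ≥0∞` is the positive part). -/
def delay (A : Finset (Fin K)) (T : Path E → ℕ∞) : ℝ≥0∞ :=
  ⨆ ν : ℕ, essSup
    (condLExp (obsFiltration E ν) (M.probChange A ν) fun ω => (T ω : ℝ≥0∞) - (ν : ℝ≥0∞))
    (M.probChange A ν)

/-- `inf_{T ∈ C_γ} J_A[T]`. -/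
def optDelay (A : Finset (Fin K)) (γ : ℝ) : ℝ≥0∞ :=
  ⨅ T ∈ M.rulesClass γ, M.delay A T

/-- Second-order asymptotic optimality, with respect to the class `P` of subsets, of the family
of detection rules `T γ`, `γ ≥ 1`: every `T γ` is in `C_γ` and, for every `A ∈ P`,
`J_A[T γ] - inf_{T ∈ C_γ} J_A[T] = O(1)` as `γ → ∞` (both terms being finite for large `γ`). -/
def SecondOrderOptimal (P : Finset (Finset (Fin K))) (T : ℝ → Path E → ℕ∞) : Prop :=
  (∀ γ : ℝ, 1 ≤ γ → T γ ∈ M.rulesClass γ) ∧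
  ∀ A ∈ P, (∀ᶠ γ in atTop, M.delay A (T γ) ≠ ∞) ∧
    (fun γ : ℝ => (M.delay A (T γ)).toReal - (M.optDelay A γ).toReal) =O[atTop]
      fun _ => (1 : ℝ)

end

end SensorModel

/-! Write `I_A` (`info`) for the total information number of the sensors in `A`. The benchmark is
`log γ / I_A`: no rule in `C_γ` has worst-case delay below it by more than a constant, and neither
of the two rules exceeds it by more than a constant. Second-order optimality is the difference of
these two bounds.

Both rules are instances of `crossRule`: stop when, over some window, the product of `ξ` applied to
each sensor's likelihood ratio reaches `c`. Whenever this happens, a mixture of subset likelihood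
ratios also reaches `c`, hence so does the same mixture of Shiryaev-Roberts statistics. Under `P_∞`
a mixture of total weight `W` grows in mean by `W` per step, so stopping it at `T` gives `W * E_∞[T]
≥ c` (`le_mul_lintegral_of_le_shiryaevRoberts`).

For the delay, `ξ y ≥ m * max 1 y` makes the product at least `m ^ K` times the likelihood ratio of
`A`. From any change point on, the rule therefore stops at the latest when a random walk with drift
`I_A` has travelled `b + O(1)`. That travel time is controlled by the potential of
`exists_passage_time_potential`, a linear function plus a bounded correction for the overshoot; the
second moment makes the correction bounded.

The lower bound is a Lorden-Moustakides argument with the CUSUM statistic `V` of `A`. Expanding `max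
V 1` over possible change points, with restart weights `(1 - V_n)^+`, shows that its accumulated
mean before `T` is at most `J_A[T] * D`, where `D` is the accumulated mean of the weights
(`sum_setLIntegral_max_cusum_le`). The drift of `√V` gives `D ≥ d`, with `d` a constant multiple of
`γ`. The drift of an `x log x` potential gives `log d * D ≤ d + I_A * J_A[T] * D`. Hence `log d ≤ 1
+ I_A * J_A[T]`. -/

/-- Changing finitely many marginals of a product measure by densities. -/
lemma infinitePi_withDensity_prod {ι : Type*} {X : ι → Type*} [∀ u, MeasurableSpace (X u)]
    (μ μ' : ∀ u, Measure (X u)) [∀ u, IsProbabilityMeasure (μ u)]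
    [∀ u, IsProbabilityMeasure (μ' u)] {f : ∀ u, X u → ℝ≥0∞} (hf : ∀ u, Measurable (f u))
    (S : Finset ι) (h1 : ∀ u ∈ S, μ' u = (μ u).withDensity (f u)) (h2 : ∀ u ∉ S, μ' u = μ u) :
    (Measure.infinitePi μ).withDensity (fun ω => ∏ u ∈ S, f u (ω u)) = Measure.infinitePi μ' := by
  classical
  refine Measure.eq_infinitePi _ fun s B hB => ?_
  have hms : MeasurableSet ((s : Set ι).pi B) := MeasurableSet.pi s.countable_toSet fun i _ => hB i
  rw [withDensity_apply _ hms, ← lintegral_indicator hms]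
  -- The indicator of the box and the density are merged into one factor per coordinate, so that
  -- independence factorizes a single product over `s ∪ S`.
  let q : ∀ u, X u → ℝ≥0∞ := fun u x =>
    (if u ∈ s then (B u).indicator 1 x else 1) * (if u ∈ S then f u x else 1)
  have hq : ∀ u, Measurable (q u) := fun u => by
    refine Measurable.mul ?_ ?_
    · split_ifs
      · exact measurable_one.indicator (hB u)
      · fun_prop
    · split_ifs <;> [exact hf u; fun_prop]
  have hind := iIndepFun_infinitePi (P := μ) (X := q) hq
  have hqi : ∀ u, ∫⁻ x, q u x ∂(μ u) = if u ∈ s then μ' u (B u) else 1 := fun u => by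
    by_cases hs : u ∈ s <;> by_cases hS : u ∈ S
    · simp only [q, hs, hS, if_true, h1 u hS]
      rw [withDensity_apply _ (hB u), ← lintegral_indicator (hB u)]
      refine lintegral_congr fun x => ?_
      by_cases hx : x ∈ B u <;> simp [hx]
    · simp only [q, hs, hS, if_true, if_false, h2 u hS, mul_one]
      exact lintegral_indicator_one (hB u)
    · have := h1 u hS
      simp only [q, hs, hS, if_true, if_false, one_mul]
      rw [← setLIntegral_univ, ← withDensity_apply _ .univ, ← this, measure_univ]
    · simp [q, hs, hS]
  calc _ = ∫⁻ ω, ∏ u ∈ s ∪ S, q u (ω u) ∂(Measure.infinitePi μ) := by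
        refine lintegral_congr fun ω => ?_
        simp only [q]
        rw [Finset.prod_mul_distrib]
        have e1 : ∏ u ∈ s ∪ S, (if u ∈ S then f u (ω u) else 1) = ∏ u ∈ S, f u (ω u) := by
          rw [Finset.prod_ite_mem, Finset.inter_eq_right.2 Finset.subset_union_right]
        have e2 : ∏ u ∈ s ∪ S, (if u ∈ s then (B u).indicator (1 : X u → ℝ≥0∞) (ω u) else 1) =
            ∏ u ∈ s, (B u).indicator (1 : X u → ℝ≥0∞) (ω u) := by
          rw [Finset.prod_ite_mem, Finset.inter_eq_right.2 Finset.subset_union_left]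
        rw [e1, e2]
        by_cases hω : ω ∈ (s : Set ι).pi B
        · have e3 : ∏ u ∈ s, (B u).indicator (1 : X u → ℝ≥0∞) (ω u) = 1 :=
            Finset.prod_eq_one fun u hu => by rw [Set.indicator_of_mem (hω u hu)]; rfl
          rw [Set.indicator_of_mem hω, e3, one_mul]
        · rw [Set.indicator_of_notMem hω]
          simp only [Set.mem_pi, not_forall] at hω
          obtain ⟨u, hu, hu'⟩ := hω
          rw [Finset.prod_eq_zero (Finset.mem_coe.1 hu) (Set.indicator_of_notMem hu' _), zero_mul]
    _ = ∏ u ∈ s ∪ S, ∫⁻ ω, q u (ω u) ∂(Measure.infinitePi μ) :=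
        lintegral_prod_eq_prod_lintegral_of_indepFun _ _ hind
          fun u => (hq u).comp (measurable_pi_apply u)
    _ = ∏ u ∈ s ∪ S, if u ∈ s then μ' u (B u) else 1 := by
        refine Finset.prod_congr rfl fun u _ => ?_
        rw [← hqi u]
        exact (measurePreserving_eval_infinitePi μ u).lintegral_comp (hq u)
    _ = ∏ u ∈ s, μ' u (B u) := by
        rw [Finset.prod_ite_mem, Finset.inter_eq_right.2 Finset.subset_union_left]

namespace SensorModel

/-! ### Product measures on path space: conditioning on the past and change of measure. -/

section PathSpace

variable {K : ℕ} {E : Fin K → Type*} [∀ k, MeasurableSpace (E k)]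

lemma obsFiltration_le (t : ℕ) :
    obsFiltration E t ≤ (inferInstance : MeasurableSpace (Path E)) :=
  (obsFiltration E).le t

lemma measurable_obsFiltration_apply {u t : ℕ} (h : u < t) :
    Measurable[obsFiltration E t] fun ω : Path E => ω u :=
  measurable_cylinderEvent_apply (Δ := Set.Iio t) h

variable (μ : ℕ → Measure (∀ k, E k)) [∀ u, IsProbabilityMeasure (μ u)]

lemma indep_obsFiltration_comap_eval (t : ℕ) :
    Indep (obsFiltration E t) (MeasurableSpace.comap (fun ω : Path E => ω t) inferInstance)
      (Measure.infinitePi μ) := by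
  have h := iIndepFun_infinitePi (P := μ) (X := fun _ x => x) (fun _ => measurable_id)
  have h' := indep_iSup_of_disjoint (S := Set.Iio t) (T := {t})
    (fun i => (measurable_pi_apply i).comap_le) h (by simp)
  simpa [obsFiltration, cylinderEvents] using h'

/-- Integrating out the coordinate `t`, given the past before `t`. -/
lemma lintegral_eq_lintegral_lintegral_eval {β : Type*} [MeasurableSpace β] {t : ℕ}
    {Y : Path E → β} (hY : Measurable[obsFiltration E t] Y)
    {G : β × (∀ k, E k) → ℝ≥0∞} (hG : Measurable G) :
    ∫⁻ ω, G (Y ω, ω t) ∂(Measure.infinitePi μ) =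
      ∫⁻ ω, ∫⁻ x, G (Y ω, x) ∂(μ t) ∂(Measure.infinitePi μ) := by
  have hY' : Measurable Y := hY.mono (obsFiltration_le t) le_rfl
  have ht : Measurable fun ω : Path E => ω t := measurable_pi_apply t
  have hind : IndepFun Y (fun ω : Path E => ω t) (Measure.infinitePi μ) :=
    indep_of_indep_of_le_left (indep_obsFiltration_comap_eval μ t) hY.comap_le
  have hmap := (indepFun_iff_map_prod_eq_prod_map_map hY'.aemeasurable ht.aemeasurable).1 hind
  have heval : (Measure.infinitePi μ).map (fun ω : Path E => ω t) = μ t :=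
    (measurePreserving_eval_infinitePi μ t).map_eq
  rw [heval] at hmap
  rw [← lintegral_map (f := G) (g := fun ω : Path E => (Y ω, ω t)) hG (hY'.prodMk ht), hmap,
    lintegral_prod _ hG.aemeasurable, lintegral_map hG.lintegral_prod_right' hY']

/-- Integrating out the coordinate `t` on an event of the past before `t`. -/
lemma setLIntegral_eq_setLIntegral_lintegral_eval {β : Type*} [MeasurableSpace β] {t : ℕ}
    {Y : Path E → β} (hY : Measurable[obsFiltration E t] Y) {B : Set (Path E)}
    (hB : MeasurableSet[obsFiltration E t] B)
    {G : β × (∀ k, E k) → ℝ≥0∞} (hG : Measurable G) :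
    ∫⁻ ω in B, G (Y ω, ω t) ∂(Measure.infinitePi μ) =
      ∫⁻ ω in B, ∫⁻ x, G (Y ω, x) ∂(μ t) ∂(Measure.infinitePi μ) := by
  have hB' : MeasurableSet B := obsFiltration_le t _ hB
  -- The event joins `Y` as an indicator, which reduces the claim to the integral over the whole
  -- space.
  have hYB : Measurable[obsFiltration E t] fun ω => (Y ω, B.indicator (1 : Path E → ℝ≥0∞) ω) :=
    hY.prodMk (Measurable.indicator (m := obsFiltration E t) measurable_const hB)
  have hG' : Measurable fun q : (β × ℝ≥0∞) × (∀ k, E k) => q.1.2 * G (q.1.1, q.2) := by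
    fun_prop
  have h := lintegral_eq_lintegral_lintegral_eval μ hYB hG'
  rw [← lintegral_indicator hB', ← lintegral_indicator hB']
  refine (lintegral_congr fun ω => ?_).trans (h.trans (lintegral_congr fun ω => ?_))
  · by_cases hω : ω ∈ B <;> simp [hω]
  · by_cases hω : ω ∈ B <;> simp [hω]

/-- Presents past events as preimages under restriction to the coordinates before `t`, so that
product measures can be compared through their restrictions. -/
lemma obsFiltration_eq_comap_domRestrict (t : ℕ) :
    (obsFiltration E t : MeasurableSpace (Path E)) =
      MeasurableSpace.comap (Set.domRestrict (Set.Iio t)) inferInstance := by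
  change cylinderEvents (Set.Iio t) = _
  simp only [cylinderEvents, MeasurableSpace.pi, MeasurableSpace.comap_iSup,
    MeasurableSpace.comap_comp]
  rw [iSup_subtype']
  rfl

variable {μ} in
/-- Two product measures with the same marginals before `t` agree on the past before `t`. -/
lemma infinitePi_apply_eq_of_marginals_eq {μ' : ℕ → Measure (∀ k, E k)}
    [∀ u, IsProbabilityMeasure (μ' u)] {t : ℕ} (h : ∀ u < t, μ u = μ' u) {B : Set (Path E)}
    (hB : MeasurableSet[obsFiltration E t] B) :
    Measure.infinitePi μ B = Measure.infinitePi μ' B := by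
  rw [obsFiltration_eq_comap_domRestrict] at hB
  obtain ⟨B', hB', rfl⟩ := hB
  have hm : Measurable (Set.domRestrict (Set.Iio t) : Path E → _) := by fun_prop
  rw [← Measure.map_apply hm hB', ← Measure.map_apply hm hB', Measure.infinitePi_map_restrict',
    Measure.infinitePi_map_restrict']
  congr 2
  ext1 u
  exact h u u.2

variable {μ} in
lemma lintegral_infinitePi_eq_of_marginals_eq {μ' : ℕ → Measure (∀ k, E k)}
    [∀ u, IsProbabilityMeasure (μ' u)] {t : ℕ} (h : ∀ u < t, μ u = μ' u) {F : Path E → ℝ≥0∞}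
    (hF : Measurable[obsFiltration E t] F) :
    ∫⁻ ω, F ω ∂(Measure.infinitePi μ) = ∫⁻ ω, F ω ∂(Measure.infinitePi μ') := by
  have htrim : (Measure.infinitePi μ).trim (obsFiltration_le t) =
      (Measure.infinitePi μ').trim (obsFiltration_le t) := by
    refine @Measure.ext _ (obsFiltration E t) _ _ fun B hB => ?_
    rw [trim_measurableSet_eq _ hB, trim_measurableSet_eq _ hB]
    exact infinitePi_apply_eq_of_marginals_eq h hB
  rw [← lintegral_trim (obsFiltration_le t) hF, ← lintegral_trim (obsFiltration_le t) hF, htrim]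

/-- Change of measure on the past before `t`. -/
lemma lintegral_infinitePi_eq_lintegral_mul_prod {f : (∀ k, E k) → ℝ≥0∞} (hf : Measurable f)
    (μ' : ℕ → Measure (∀ k, E k)) [∀ u, IsProbabilityMeasure (μ' u)] {s t : ℕ}
    (h1 : ∀ u, s ≤ u → u < t → μ' u = (μ u).withDensity f) (h2 : ∀ u < s, u < t → μ' u = μ u)
    {F : Path E → ℝ≥0∞} (hF : Measurable[obsFiltration E t] F) :
    ∫⁻ ω, F ω ∂(Measure.infinitePi μ') =
      ∫⁻ ω, F ω * ∏ u ∈ Finset.Ico s t, f (ω u) ∂(Measure.infinitePi μ) := by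
  -- `μ''` switches back to `μ` from time `t` on: it agrees with `μ'` on the past and differs from
  -- `μ` in only finitely many coordinates.
  let μ'' : ℕ → Measure (∀ k, E k) := fun u => if u < t then μ' u else μ u
  have hp : ∀ u, IsProbabilityMeasure (μ'' u) := fun u => by
    simp only [μ'']; split_ifs <;> infer_instance
  have e1 : ∫⁻ ω, F ω ∂(Measure.infinitePi μ') = ∫⁻ ω, F ω ∂(Measure.infinitePi μ'') :=
    lintegral_infinitePi_eq_of_marginals_eq (fun u hu => by simp [μ'', hu]) hF
  have e2 := infinitePi_withDensity_prod μ μ'' (fun _ => hf) (Finset.Ico s t)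
    (fun u hu => by
      rw [Finset.mem_Ico] at hu
      simp only [μ'', hu.2, if_true]
      exact h1 u hu.1 hu.2)
    (fun u hu => by
      rw [Finset.mem_Ico, not_and, not_lt] at hu
      by_cases hut : u < t
      · simp only [μ'', hut, if_true]
        exact h2 u (by by_contra hc; exact absurd (hu (not_lt.1 hc)) (not_le.2 hut)) hut
      · simp [μ'', hut])
  have hm : Measurable fun ω : Path E => ∏ u ∈ Finset.Ico s t, f (ω u) :=
    Finset.measurable_fun_prod _ fun u _ => hf.comp (measurable_pi_apply u)
  rw [e1, ← e2, lintegral_withDensity_eq_lintegral_mul _ hm (hF.mono (obsFiltration_le t) le_rfl)]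
  simp [mul_comm]

end PathSpace

end SensorModel

/-! ### Likelihood ratios and the Hellinger affinity. -/

section LikelihoodRatio

variable {X : Type*} [MeasurableSpace X] {μ ν : Measure X} {L : X → ℝ≥0∞}

lemma ae_density_ne_zero (hL : Measurable L) (hν : ν = μ.withDensity L) :
    ∀ᵐ x ∂ν, L x ≠ 0 := by
  rw [hν, ae_withDensity_iff hL]
  exact ae_of_all _ fun x h => h

variable [IsProbabilityMeasure ν]

lemma lintegral_density_eq_one (hν : ν = μ.withDensity L) : ∫⁻ x, L x ∂μ = 1 := by
  rw [← setLIntegral_univ, ← withDensity_apply _ .univ, ← hν, measure_univ]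

lemma ae_density_ne_top (hL : Measurable L) (hν : ν = μ.withDensity L) :
    ∀ᵐ x ∂μ, L x ≠ ∞ := by
  filter_upwards [ae_lt_top hL (by simp [lintegral_density_eq_one hν])] with x hx using hx.ne

lemma ae_density_ne_top' (hL : Measurable L) (hν : ν = μ.withDensity L) :
    ∀ᵐ x ∂ν, L x ≠ ∞ :=
  (hν ▸ withDensity_absolutelyContinuous μ L : ν ≪ μ).ae_le (ae_density_ne_top hL hν)

variable [IsProbabilityMeasure μ]

/-- The Hellinger affinity of two distributions with positive Kullback-Leibler divergence is
less than one. -/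
lemma lintegral_sqrt_density_lt_one (hL : Measurable L) (hν : ν = μ.withDensity L)
    (hI : ∫ x, Real.log (L x).toReal ∂ν ≠ 0) : ∫⁻ x, L x ^ (1 / 2 : ℝ) ∂μ < 1 := by
  by_contra! hge
  -- This is `(√a - 1)^2 ≥ 0` with its equality case. An affinity of at least one would force
  -- equality almost everywhere, hence `L = 1` and zero information.
  have key : ∀ a : ℝ, 0 ≤ a → 2 * a ^ (1 / 2 : ℝ) ≤ 1 + a ∧ (2 * a ^ (1 / 2 : ℝ) = 1 + a → a = 1) := by
    intro a ha
    rw [← Real.sqrt_eq_rpow]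
    have h1 := Real.sq_sqrt ha
    refine ⟨by nlinarith [sq_nonneg (Real.sqrt a - 1)], fun h => ?_⟩
    have h2 : Real.sqrt a = 1 := by nlinarith [sq_nonneg (Real.sqrt a - 1)]
    nlinarith
  have hcast : ∀ x, L x ≠ ∞ → L x = ENNReal.ofReal (L x).toReal := fun x h =>
    (ENNReal.ofReal_toReal h).symm
  have e : ∀ a : ℝ, 0 ≤ a → (2 * ENNReal.ofReal a ^ (1 / 2 : ℝ) : ℝ≥0∞) =
      ENNReal.ofReal (2 * a ^ (1 / 2 : ℝ)) := fun a ha => by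
    rw [ENNReal.ofReal_rpow_of_nonneg ha (by norm_num), ENNReal.ofReal_mul (by norm_num)]
    simp
  have e' : ∀ a : ℝ, 0 ≤ a → (1 + ENNReal.ofReal a : ℝ≥0∞) = ENNReal.ofReal (1 + a) :=
    fun a ha => by rw [ENNReal.ofReal_add (by norm_num) ha]; simp
  have hle : (fun x => 2 * L x ^ (1 / 2 : ℝ)) ≤ᵐ[μ] fun x => 1 + L x := by
    filter_upwards [ae_density_ne_top hL hν] with x hx
    rw [hcast x hx, e _ ENNReal.toReal_nonneg, e' _ ENNReal.toReal_nonneg]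
    exact ENNReal.ofReal_le_ofReal (key _ ENNReal.toReal_nonneg).1
  have hint : ∫⁻ x, (1 + L x) ∂μ = 2 := by
    rw [lintegral_add_left measurable_const, lintegral_density_eq_one hν]
    simp [one_add_one_eq_two]
  have hint' : ∫⁻ x, 2 * L x ^ (1 / 2 : ℝ) ∂μ = 2 * ∫⁻ x, L x ^ (1 / 2 : ℝ) ∂μ :=
    lintegral_const_mul _ (by fun_prop)
  have heq := ae_eq_of_ae_le_of_lintegral_le hle
    (((lintegral_mono_ae hle).trans_eq hint).trans_lt (by simp)).ne (by fun_prop)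
    (by rw [hint, hint']; calc (2 : ℝ≥0∞) = 2 * 1 := by simp
          _ ≤ _ := by gcongr)
  refine hI ?_
  have h1 : ∀ᵐ x ∂μ, L x = 1 := by
    filter_upwards [heq, ae_density_ne_top hL hν] with x hx hxt
    rw [hcast x hxt, e _ ENNReal.toReal_nonneg, e' _ ENNReal.toReal_nonneg,
      ENNReal.ofReal_eq_ofReal_iff (mul_nonneg (by norm_num) (Real.rpow_nonneg ENNReal.toReal_nonneg _))
        (add_nonneg (by norm_num) ENNReal.toReal_nonneg)] at hx
    rw [hcast x hxt, (key _ ENNReal.toReal_nonneg).2 hx, ENNReal.ofReal_one]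
  have h2 : ∀ᵐ x ∂ν, L x = 1 :=
    (hν ▸ withDensity_absolutelyContinuous μ L : ν ≪ μ).ae_le h1
  rw [integral_eq_zero_of_ae]
  filter_upwards [h2] with x hx
  simp [hx]

/-- Because `ν` has density `L`, the integral of `L^(-1/2)` against `ν` is that of `L^(1/2)` against
`μ` over `L > 0`, so the affinity bound applies. It gives the exponentials in the passage-time
potential a strict downward drift. -/
lemma lintegral_exp_neg_half_log_density_lt_one (hL : Measurable L) (hν : ν = μ.withDensity L)
    (hI : ∫ x, Real.log (L x).toReal ∂ν ≠ 0) :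
    ∫⁻ x, ENNReal.ofReal (Real.exp (-Real.log (L x).toReal / 2)) ∂ν < 1 := by
  refine lt_of_le_of_lt ?_ (lintegral_sqrt_density_lt_one hL hν hI)
  have hm : Measurable fun x => ENNReal.ofReal (Real.exp (-Real.log (L x).toReal / 2)) := by
    fun_prop
  conv_lhs => rw [hν]
  rw [lintegral_withDensity_eq_lintegral_mul _ hL hm]
  refine lintegral_mono_ae ?_
  filter_upwards [ae_density_ne_top hL hν] with x hx
  by_cases h0 : L x = 0
  · simp [h0]
  have hpos : 0 < (L x).toReal := ENNReal.toReal_pos h0 hx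
  simp only [Pi.mul_apply]
  have e1 : L x = ENNReal.ofReal (L x).toReal := (ENNReal.ofReal_toReal hx).symm
  have e2 : L x ^ (1 / 2 : ℝ) = ENNReal.ofReal ((L x).toReal ^ (1 / 2 : ℝ)) := by
    rw [← ENNReal.ofReal_rpow_of_pos hpos, ← e1]
  rw [e2]
  nth_rewrite 1 [e1]
  rw [← ENNReal.ofReal_mul hpos.le]
  refine ENNReal.ofReal_le_ofReal (le_of_eq ?_)
  rw [Real.rpow_def_of_pos hpos]
  nth_rewrite 1 [← Real.exp_log hpos]
  rw [← Real.exp_add]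
  ring_nf

end LikelihoodRatio

namespace SensorModel

/-! ### Likelihood ratios and information numbers of the sensor model. -/

section Model

variable {K : ℕ} {E : Fin K → Type*} [∀ k, MeasurableSpace (E k)] (M : SensorModel E)

/-- The likelihood ratio `g_k / h_k` of sensor `k`. -/
noncomputable def lr (k : Fin K) (x : E k) : ℝ≥0∞ := M.g k x / M.h k x

/-- The likelihood ratio of the sensors in `A`. -/
noncomputable def lrProd (A : Finset (Fin K)) (x : ∀ k, E k) : ℝ≥0∞ := ∏ k ∈ A, M.lr k (x k)

@[fun_prop]
lemma measurable_lr (k : Fin K) : Measurable (M.lr k) := (M.measurable_g k).div (M.measurable_h k)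

@[fun_prop]
lemma measurable_lrProd (A : Finset (Fin K)) : Measurable (M.lrProd A) := by
  unfold lrProd
  exact Finset.measurable_fun_prod _ fun k _ => (M.measurable_lr k).comp (measurable_pi_apply k)

lemma exp_localLLR (k : Fin K) (x : E k) : EReal.exp (M.localLLR k x) = M.lr k x := by
  simp [localLLR, lr]

lemma exp_incr (s t : ℕ) (k : Fin K) (ω : Path E) :
    EReal.exp (M.incr s t k ω) = ∏ u ∈ Finset.Ico s t, M.lr k (ω u k) := by
  unfold incr
  induction Finset.Ico s t using Finset.induction_on with
  | empty => simp
  | insert u S hu ih => rw [Finset.sum_insert hu, Finset.prod_insert hu, EReal.exp_add, ih,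
      exp_localLLR]

variable {M}

/-- Absolute continuity forces `g = 0` almost everywhere on `{h = 0}`, where the convention `0 / 0 =
0` does no harm; elsewhere `h * (g / h) = g` since `h` is almost everywhere finite. -/
lemma postLaw_eq_withDensity {k : Fin K} (hac : M.postLaw k ≪ M.preLaw k) :
    M.postLaw k = (M.preLaw k).withDensity (M.lr k) := by
  have hh := M.measurable_h k
  have hg := M.measurable_g k
  have htop : ∀ᵐ x ∂(M.ref k), M.h k x ≠ ∞ := by
    filter_upwards [ae_lt_top hh (by simp [M.lintegral_h])] with x hx using hx.ne
  have hzero : ∀ᵐ x ∂(M.ref k), M.h k x = 0 → M.g k x = 0 := by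
    have h0 : M.preLaw k {x | M.h k x = 0} = 0 := by
      have hs : MeasurableSet {x | M.h k x = 0} := hh (measurableSet_singleton 0)
      rw [preLaw, withDensity_apply _ hs,
        setLIntegral_congr_fun hs (g := 0) (fun x hx => hx)]
      simp
    have h1 : ∀ᵐ x ∂(M.postLaw k), M.h k x ≠ 0 := by
      rw [ae_iff]; simpa using hac h0
    rw [postLaw, ae_withDensity_iff hg] at h1
    filter_upwards [h1] with x hx h0
    by_contra hc
    exact hx hc h0
  unfold postLaw preLaw
  rw [← withDensity_mul _ hh (M.measurable_lr k)]
  refine withDensity_congr_ae ?_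
  filter_upwards [htop, hzero] with x h1 h2
  simp only [Pi.mul_apply, lr]
  by_cases h0 : M.h k x = 0
  · simp [h0, h2 h0]
  · rw [ENNReal.mul_div_cancel h0 h1]

lemma stepLaw_eq_withDensity (hac : ∀ k, M.postLaw k ≪ M.preLaw k) (A : Finset (Fin K)) :
    M.stepLaw A = (M.stepLaw ∅).withDensity (M.lrProd A) := by
  unfold stepLaw
  rw [← Measure.infinitePi_eq_pi, ← Measure.infinitePi_eq_pi]
  refine (infinitePi_withDensity_prod _ _ M.measurable_lr A (fun k hk => ?_) fun k hk => ?_).symm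
  · simpa [sensorLaw, hk] using postLaw_eq_withDensity (hac k)
  · simp [sensorLaw, hk]

lemma measurePreserving_eval_stepLaw {A : Finset (Fin K)} {k : Fin K} (hk : k ∈ A) :
    MeasurePreserving (fun x : ∀ k, E k => x k) (M.stepLaw A) (M.postLaw k) := by
  have h := measurePreserving_eval (μ := M.sensorLaw A) k
  have e : M.sensorLaw A k = M.postLaw k := by simp [sensorLaw, hk]
  rw [e] at h
  exact h

/-- The log-likelihood ratio of the sensors in `A`, as a real number. -/
noncomputable def llrSum (M : SensorModel E) (A : Finset (Fin K)) (x : ∀ k, E k) : ℝ :=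
  Real.log (M.lrProd A x).toReal

@[fun_prop]
lemma measurable_llrSum (A : Finset (Fin K)) : Measurable (M.llrSum A) := by
  unfold llrSum; fun_prop

lemma ae_lr_ne (hac : ∀ k, M.postLaw k ≪ M.preLaw k) (A : Finset (Fin K)) :
    ∀ᵐ x ∂(M.stepLaw A), ∀ k ∈ A, M.lr k (x k) ≠ 0 ∧ M.lr k (x k) ≠ ∞ := by
  refine (ae_ball_iff A.countable_toSet).2 ?_
  intro k hk
  refine (measurePreserving_eval_stepLaw hk).quasiMeasurePreserving.ae
    (p := fun y => M.lr k y ≠ 0 ∧ M.lr k y ≠ ∞) ?_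
  exact (ae_density_ne_zero (M.measurable_lr k) (postLaw_eq_withDensity (hac k))).and
    (ae_density_ne_top' (M.measurable_lr k) (postLaw_eq_withDensity (hac k)))

lemma ae_llrSum_eq (hac : ∀ k, M.postLaw k ≪ M.preLaw k) (A : Finset (Fin K)) :
    ∀ᵐ x ∂(M.stepLaw A), M.llrSum A x = ∑ k ∈ A, Real.log (M.lr k (x k)).toReal := by
  filter_upwards [ae_lr_ne hac A] with x hx
  rw [llrSum, lrProd, ENNReal.toReal_prod, Real.log_prod]
  exact fun k hk => (ENNReal.toReal_pos (hx k hk).1 (hx k hk).2).ne'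

lemma ae_sum_localLLR_eq (hac : ∀ k, M.postLaw k ≪ M.preLaw k) (A : Finset (Fin K)) :
    ∀ᵐ x ∂(M.stepLaw A), (∑ k ∈ A, M.localLLR k (x k)).toReal = M.llrSum A x := by
  filter_upwards [ae_lr_ne hac A, ae_llrSum_eq hac A] with x hx hx'
  rw [hx']
  have : ∑ k ∈ A, M.localLLR k (x k) =
      ((∑ k ∈ A, Real.log (M.lr k (x k)).toReal : ℝ) : EReal) := by
    have hc : ∀ (S : Finset (Fin K)) (r : Fin K → ℝ),
        ((∑ k ∈ S, r k : ℝ) : EReal) = ∑ k ∈ S, (r k : EReal) := fun S r => by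
      induction S using Finset.induction_on with
      | empty => simp
      | insert a S ha ih => rw [Finset.sum_insert ha, Finset.sum_insert ha, EReal.coe_add, ih]
    rw [hc]
    exact Finset.sum_congr rfl fun k hk => ENNReal.log_pos_real (hx k hk).1 (hx k hk).2
  rw [this, EReal.toReal_coe]

lemma ae_log_lr_eq_llr {k : Fin K} (hac : M.postLaw k ≪ M.preLaw k) :
    (fun x => Real.log (M.lr k x).toReal) =ᵐ[M.postLaw k] llr (M.postLaw k) (M.preLaw k) := by
  have h := Measure.rnDeriv_withDensity (M.preLaw k) (M.measurable_lr k)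
  rw [← postLaw_eq_withDensity hac] at h
  filter_upwards [hac.ae_le h] with x hx
  rw [llr, hx]

/-- The information number of the sensors in `A`. -/
noncomputable def info (M : SensorModel E) (A : Finset (Fin K)) : ℝ :=
  ∑ k ∈ A, (M.localKL k).toReal

lemma integrable_llrSum (hI : ∀ k, M.localKL k ≠ ∞) (A : Finset (Fin K)) :
    Integrable (M.llrSum A) (M.stepLaw A) ∧ ∫ x, M.llrSum A x ∂(M.stepLaw A) = M.info A := by
  have hI' := fun k => InformationTheory.klDiv_ne_top_iff.1 (hI k)
  have hint : ∀ k, Integrable (fun x => Real.log (M.lr k x).toReal) (M.postLaw k) := fun k =>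
    (hI' k).2.congr (ae_log_lr_eq_llr (hI' k).1).symm
  have hint' : ∀ k ∈ A, Integrable (fun x : ∀ k, E k => Real.log (M.lr k (x k)).toReal)
      (M.stepLaw A) := fun k hk =>
    (measurePreserving_eval_stepLaw hk).integrable_comp_of_integrable (hint k)
  have hae := ae_llrSum_eq (fun k => (hI' k).1) A
  refine ⟨(integrable_finsetSum A hint').congr (hae.mono fun x hx => hx.symm), ?_⟩
  rw [integral_congr_ae hae, integral_finsetSum A hint']
  refine Finset.sum_congr rfl fun k hk => ?_
  rw [localKL, InformationTheory.toReal_klDiv_of_measure_eq (hI' k).1 (by simp),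
    ← integral_congr_ae (ae_log_lr_eq_llr (hI' k).1),
    ← (measurePreserving_eval_stepLaw (M := M) hk).map_eq, integral_map]
  · exact (measurable_pi_apply k).aemeasurable
  · exact ((M.measurable_lr k).ennreal_toReal.log).aestronglyMeasurable

lemma info_pos (hI : ∀ k, 0 < M.localKL k ∧ M.localKL k ≠ ∞) {A : Finset (Fin K)}
    (hA : A.Nonempty) : 0 < M.info A :=
  Finset.sum_pos (fun k _ => ENNReal.toReal_pos (hI k).1.ne' (hI k).2) hA

lemma memLp_llrSum (hI : ∀ k, M.localKL k ≠ ∞) {A : Finset (Fin K)}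
    (h : MemLp (M.firstLLR A) 2 (M.probChange A 0)) : MemLp (M.llrSum A) 2 (M.stepLaw A) := by
  have hmp : MeasurePreserving (fun ω : Path E => ω 0) (M.probChange A 0) (M.stepLaw A) :=
    measurePreserving_eval_infinitePi (fun _ : ℕ => M.stepLaw (if 0 ≤ _ then A else ∅)) 0
  rw [← hmp.map_eq, memLp_map_measure_iff (measurable_llrSum A).aestronglyMeasurable
    hmp.measurable.aemeasurable]
  refine h.ae_eq ?_
  have hae := hmp.quasiMeasurePreserving.ae (ae_sum_localLLR_eq
    (fun k => (InformationTheory.klDiv_ne_top_iff.1 (hI k)).1) A)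
  filter_upwards [hae] with ω hω
  simpa [firstLLR] using hω

end Model

end SensorModel

/-! ### A potential for the passage time of a random walk with positive drift. -/

section Potential

/-- At most `⌈a⌉` terms are nonzero, each at most `a`. Applied to `a = ℓ x`, it turns the second
moment into summability of the mean overshoots over integer levels. -/
lemma tsum_ofReal_sub_natCast_le (a : ℝ) :
    ∑' j : ℕ, ENNReal.ofReal (a - j) ≤ ENNReal.ofReal (a ^ 2 + |a|) := by
  rw [tsum_eq_sum (s := Finset.range ⌈a⌉₊)
    (fun j hj => ENNReal.ofReal_eq_zero.2 (by
      have := Nat.ceil_le.1 (not_lt.1 fun h => hj (Finset.mem_range.2 h)); linarith))]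
  rcases le_or_gt a 0 with ha | ha
  · simp [Nat.ceil_eq_zero.2 ha]
  · calc ∑ j ∈ Finset.range ⌈a⌉₊, ENNReal.ofReal (a - j)
        ≤ ∑ j ∈ Finset.range ⌈a⌉₊, ENNReal.ofReal a := by
          gcongr with j hj
          linarith [(Nat.cast_nonneg j : (0 : ℝ) ≤ j)]
      _ = ENNReal.ofReal (⌈a⌉₊ * a) := by
          rw [Finset.sum_const, Finset.card_range, nsmul_eq_mul,
            ENNReal.ofReal_mul (Nat.cast_nonneg _), ENNReal.ofReal_natCast]
      _ ≤ _ := by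
          refine ENNReal.ofReal_le_ofReal ?_
          have := (Nat.ceil_lt_add_one ha.le).le
          rw [abs_of_pos ha]
          nlinarith

variable {X : Type*} [MeasurableSpace X] {ν : Measure X} [IsProbabilityMeasure ν] {ℓ : X → ℝ}

lemma tsum_lintegral_ofReal_sub_natCast_ne_top (hℓ : Measurable ℓ) (h2 : MemLp ℓ 2 ν) :
    ∑' j : ℕ, ∫⁻ x, ENNReal.ofReal (ℓ x - j) ∂ν ≠ ∞ := by
  rw [← lintegral_tsum (fun j => by fun_prop)]
  have hint : Integrable (fun x => ℓ x ^ 2 + |ℓ x|) ν :=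
    h2.integrable_sq.add (h2.integrable (by norm_num)).abs
  exact ((lintegral_mono fun x => tsum_ofReal_sub_natCast_le (ℓ x)).trans_lt
    hint.lintegral_lt_top).ne

/-- Integrates `(a - ℓ)^+ + ℓ = a + (ℓ - a)^+`: in one step the positive part of the distance falls
in mean by the drift, except for the mean overshoot. -/
lemma lintegral_ofReal_sub_add (hint : Integrable ℓ ν) (hI : 0 ≤ ∫ x, ℓ x ∂ν) {a : ℝ}
    (ha : 0 ≤ a) :
    ∫⁻ x, ENNReal.ofReal (a - ℓ x) ∂ν + ENNReal.ofReal (∫ x, ℓ x ∂ν) =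
      ENNReal.ofReal a + ∫⁻ x, ENNReal.ofReal (ℓ x - a) ∂ν := by
  have i1 : Integrable (fun x => max (a - ℓ x) 0) ν := ((integrable_const a).sub hint).pos_part
  have i2 : Integrable (fun x => max (ℓ x - a) 0) ν := (hint.sub (integrable_const a)).pos_part
  have e1 : ∫⁻ x, ENNReal.ofReal (a - ℓ x) ∂ν = ENNReal.ofReal (∫ x, max (a - ℓ x) 0 ∂ν) := by
    rw [ofReal_integral_eq_lintegral_ofReal i1 (ae_of_all _ fun x => le_max_right _ _)]
    simp
  have e2 : ∫⁻ x, ENNReal.ofReal (ℓ x - a) ∂ν = ENNReal.ofReal (∫ x, max (ℓ x - a) 0 ∂ν) := by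
    rw [ofReal_integral_eq_lintegral_ofReal i2 (ae_of_all _ fun x => le_max_right _ _)]
    simp
  have n1 : 0 ≤ ∫ x, max (a - ℓ x) 0 ∂ν := integral_nonneg fun x => le_max_right _ _
  have n2 : 0 ≤ ∫ x, max (ℓ x - a) 0 ∂ν := integral_nonneg fun x => le_max_right _ _
  rw [e1, e2, ← ENNReal.ofReal_add n1 hI, ← ENNReal.ofReal_add ha n2, ← integral_add i1 hint]
  congr 1
  have : ∀ x, max (a - ℓ x) 0 + ℓ x = a + max (ℓ x - a) 0 := fun x => by
    rcases le_total (a - ℓ x) 0 with h | h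
    · rw [max_eq_right h, max_eq_left (by linarith)]; ring
    · rw [max_eq_left h, max_eq_right (by linarith)]; ring
  simp_rw [this]
  rw [integral_add (integrable_const a) i2]
  simp

/-- A potential that dominates the expected time a random walk with steps `ℓ` needs to travel the
distance `x`, and that exceeds `x / E[ℓ]` at most by a constant. -/
lemma exists_passage_time_potential (hℓ : Measurable ℓ) (h2 : MemLp ℓ 2 ν)
    (hI : 0 < ∫ x, ℓ x ∂ν) (hρ : ∫⁻ x, ENNReal.ofReal (Real.exp (-ℓ x / 2)) ∂ν < 1) :
    ∃ C : ℝ, 0 ≤ C ∧ ∃ u : ℝ → ℝ≥0∞, Measurable u ∧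
      (∀ a, u a ≤ ENNReal.ofReal (a / ∫ x, ℓ x ∂ν) + ENNReal.ofReal C) ∧
      ∀ a, 0 < a → ∫⁻ x, u (a - ℓ x) ∂ν + 1 ≤ u a := by
  set I := ∫ x, ℓ x ∂ν with hIdef
  set ρ := ∫⁻ x, ENNReal.ofReal (Real.exp (-ℓ x / 2)) ∂ν with hρdef
  set G : ℕ → ℝ≥0∞ := fun j => ∫⁻ x, ENNReal.ofReal (ℓ x - j) ∂ν with hG
  have hGsum : ∑' j, G j ≠ ∞ := tsum_lintegral_ofReal_sub_natCast_ne_top hℓ h2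
  set κ : ℝ≥0∞ := (1 - ρ) * ENNReal.ofReal (Real.exp (-1 / 2)) with hκ
  have hκ0 : κ ≠ 0 := mul_ne_zero (tsub_pos_of_lt hρ).ne'
    (ENNReal.ofReal_pos.2 (Real.exp_pos _)).ne'
  have hκt : κ ≠ ∞ := ENNReal.mul_ne_top (ENNReal.sub_ne_top ENNReal.one_ne_top)
    ENNReal.ofReal_ne_top
  have hI0 : ENNReal.ofReal I ≠ 0 := (ENNReal.ofReal_pos.2 hI).ne'
  -- `w j` is bounded by one, does not increase in mean under a step, and drops by at least `κ` from
  -- any point of `[j, j + 1)`. Weighted by `κ⁻¹ * G j`, it pays for the overshoot from that cell.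
  set w : ℕ → ℝ → ℝ≥0∞ := fun j a =>
    min 1 (ENNReal.ofReal (Real.exp ((a - j - 1) / 2))) with hw
  have hwm : ∀ j, Measurable (w j) := fun j => by fun_prop
  have hexp : ∀ (j : ℕ) (a : ℝ), ∫⁻ x, w j (a - ℓ x) ∂ν ≤
      ρ * ENNReal.ofReal (Real.exp ((a - j - 1) / 2)) := fun j a => by
    rw [hρdef, ← lintegral_mul_const _ (by fun_prop)]
    refine lintegral_mono fun x => (min_le_right _ _).trans (le_of_eq ?_)
    rw [← ENNReal.ofReal_mul (Real.exp_pos _).le, ← Real.exp_add]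
    ring_nf
  have hsuper : ∀ (j : ℕ) (a : ℝ), ∫⁻ x, w j (a - ℓ x) ∂ν ≤ w j a := fun j a => by
    refine le_min ?_ ((hexp j a).trans (mul_le_of_le_one_left' hρ.le))
    calc _ ≤ ∫⁻ _, 1 ∂ν := lintegral_mono fun x => min_le_left _ _
      _ = 1 := by simp
  -- For `j = ⌊a⌋₊` the minimum defining `w j a` is the exponential, which one step multiplies by at
  -- most `ρ` in mean. It is at least `exp (-1/2)`, whence the second factor of `κ`.
  have hdrift : ∀ a : ℝ, 0 < a →
      ∫⁻ x, w ⌊a⌋₊ (a - ℓ x) ∂ν + κ ≤ w ⌊a⌋₊ a := fun a ha => by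
    have h1 := Nat.floor_le ha.le
    have h3 := (Nat.lt_floor_add_one a).le
    have e : w ⌊a⌋₊ a = ENNReal.ofReal (Real.exp ((a - ⌊a⌋₊ - 1) / 2)) := by
      refine min_eq_right ?_
      rw [← ENNReal.ofReal_one]
      exact ENNReal.ofReal_le_ofReal (Real.exp_le_one_iff.2 (by linarith))
    calc _ ≤ ρ * w ⌊a⌋₊ a + (1 - ρ) * w ⌊a⌋₊ a := by
          rw [hκ, e]
          gcongr
          · exact hexp _ a
          · linarith
      _ = w ⌊a⌋₊ a := by rw [← add_mul, add_tsub_cancel_of_le hρ.le, one_mul]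
  have hsum : ∀ a : ℝ, 0 < a →
      ∑' j, G j * ∫⁻ x, w j (a - ℓ x) ∂ν + κ * G ⌊a⌋₊ ≤ ∑' j, G j * w j a := fun a ha => by
    rw [← tsum_ite_eq ⌊a⌋₊ (fun _ => κ * G ⌊a⌋₊), ← ENNReal.tsum_add]
    refine ENNReal.tsum_le_tsum fun j => ?_
    split_ifs with hj
    · subst hj
      rw [mul_comm κ, ← mul_add]
      exact mul_le_mul_right (hdrift a ha) _
    · rw [add_zero]
      exact mul_le_mul_right (hsuper j a) _
  refine ⟨(κ⁻¹ * (∑' j, G j) / ENNReal.ofReal I).toReal, ENNReal.toReal_nonneg,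
    fun a => (ENNReal.ofReal a + κ⁻¹ * ∑' j, G j * w j a) / ENNReal.ofReal I, by fun_prop, ?_, ?_⟩
  · intro a
    have hC : κ⁻¹ * (∑' j, G j) / ENNReal.ofReal I ≠ ∞ :=
      ENNReal.div_ne_top (ENNReal.mul_ne_top (ENNReal.inv_ne_top.2 hκ0) hGsum) hI0
    rw [ENNReal.ofReal_toReal hC, ENNReal.ofReal_div_of_pos hI, ← ENNReal.add_div]
    refine ENNReal.div_le_div_right (add_le_add_right (mul_le_mul_right
      (ENNReal.tsum_le_tsum fun j => ?_) _) _) _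
    exact mul_le_of_le_one_right' (min_le_left _ _)
  · intro a ha
    have hm : Measurable fun x => ENNReal.ofReal (a - ℓ x) := by fun_prop
    have e1 : ∫⁻ x, (ENNReal.ofReal (a - ℓ x) + κ⁻¹ * ∑' j, G j * w j (a - ℓ x)) /
        ENNReal.ofReal I ∂ν = (∫⁻ x, ENNReal.ofReal (a - ℓ x) ∂ν +
          κ⁻¹ * ∑' j, G j * ∫⁻ x, w j (a - ℓ x) ∂ν) / ENNReal.ofReal I := by
      simp_rw [div_eq_mul_inv]
      rw [lintegral_mul_const _ (by fun_prop), lintegral_add_left hm,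
        lintegral_const_mul _ (by fun_prop), lintegral_tsum (fun j => by fun_prop)]
      congr 4
      funext j
      exact lintegral_const_mul _ (by fun_prop)
    have e2 : (1 : ℝ≥0∞) = ENNReal.ofReal I / ENNReal.ofReal I :=
      (ENNReal.div_self hI0 ENNReal.ofReal_ne_top).symm
    beta_reduce
    rw [e1, e2, ← ENNReal.add_div]
    gcongr ?_ / _
    -- The overshoot from `a` is at most that from `⌊a⌋₊`, exactly what the drop of the correction
    -- term covers.
    have hg : ∫⁻ x, ENNReal.ofReal (ℓ x - a) ∂ν ≤ κ⁻¹ * (κ * G ⌊a⌋₊) := by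
      rw [← mul_assoc, ENNReal.inv_mul_cancel hκ0 hκt, one_mul]
      refine lintegral_mono fun x => ENNReal.ofReal_le_ofReal ?_
      linarith [Nat.floor_le ha.le]
    calc _ = (∫⁻ x, ENNReal.ofReal (a - ℓ x) ∂ν + ENNReal.ofReal I) +
          κ⁻¹ * ∑' j, G j * ∫⁻ x, w j (a - ℓ x) ∂ν := by ring
      _ = ENNReal.ofReal a + (κ⁻¹ * ∑' j, G j * ∫⁻ x, w j (a - ℓ x) ∂ν +
          ∫⁻ x, ENNReal.ofReal (ℓ x - a) ∂ν) := by
        rw [lintegral_ofReal_sub_add (h2.integrable (by norm_num)) hI.le ha.le]; ring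
      _ ≤ ENNReal.ofReal a + (κ⁻¹ * ∑' j, G j * ∫⁻ x, w j (a - ℓ x) ∂ν +
          κ⁻¹ * (κ * G ⌊a⌋₊)) := by gcongr
      _ ≤ _ := by
        rw [← mul_add]
        gcongr
        exact hsum a ha

end Potential

/-! ### Delays and conditional expectations. -/

section Delay

/-- The delay as a sum of survival indicators. -/
lemma ENat.toENNReal_sub_natCast_eq_tsum (T : ℕ∞) (n : ℕ) :
    (T : ℝ≥0∞) - (n : ℝ≥0∞) = ∑' i : ℕ, if ((n + i : ℕ) : ℕ∞) < T then 1 else 0 := by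
  induction T using ENat.recTopCoe with
  | top => simp
  | coe m =>
    rw [tsum_eq_sum (s := Finset.range (m - n)) (fun i hi => if_neg (by
      rw [Finset.mem_range] at hi; rw [Nat.cast_lt]; omega))]
    rw [Finset.sum_congr rfl (fun i hi => if_pos (by
      rw [Finset.mem_range] at hi; rw [Nat.cast_lt]; omega))]
    simp

lemma condLExp_le_const {Ω : Type*} {m m0 : MeasurableSpace Ω} (hm : m ≤ m0) {P : Measure Ω}
    [IsFiniteMeasure P] {f : Ω → ℝ≥0∞} {c : ℝ≥0∞}
    (h : ∀ B, MeasurableSet[m] B → ∫⁻ ω in B, f ω ∂P ≤ c * P B) :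
    ∀ᵐ ω ∂P, condLExp m P f ω ≤ c := by
  refine ae_le_of_ae_le_trim (hm := hm) ?_
  refine ae_le_of_forall_setLIntegral_le_of_sigmaFinite (measurable_condLExp m P f)
    fun B hB _ => ?_
  rw [setLIntegral_trim hm (measurable_condLExp m P f) hB, setLIntegral_condLExp hm P f hB,
    setLIntegral_const, trim_measurableSet_eq hm hB]
  exact h B hB

end Delay

namespace SensorModel

/-! ### Upper bound on the worst-case delay. -/

section UpperBound

variable {K : ℕ} {E : Fin K → Type*} [∀ k, MeasurableSpace (E k)] {M : SensorModel E}

instance (A : Finset (Fin K)) (n : ℕ) : IsProbabilityMeasure (M.probChange A n) := by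
  unfold probChange; infer_instance

instance : IsProbabilityMeasure M.probInf := by
  unfold probInf; infer_instance

lemma measurableSet_natCast_lt {T : Path E → ℕ∞} (hT : IsStoppingTime (obsFiltration E) T)
    (t : ℕ) : MeasurableSet[obsFiltration E t] {ω | (t : ℕ∞) < T ω} := by
  have h := (hT t).compl
  have e : {ω | T ω ≤ ((t : ℕ) : WithTop ℕ)}ᶜ = {ω | (t : ℕ∞) < T ω} :=
    Set.ext fun ω => not_le (a := T ω) (b := (t : ℕ∞))
  exact e ▸ h

lemma ae_lrProd_ne (hac : ∀ k, M.postLaw k ≪ M.preLaw k) (A : Finset (Fin K)) (n : ℕ) :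
    ∀ᵐ ω ∂(M.probChange A n), ∀ u, n ≤ u → M.lrProd A (ω u) ≠ 0 ∧ M.lrProd A (ω u) ≠ ∞ := by
  rw [ae_all_iff]
  intro u
  by_cases hu : n ≤ u
  · have hmp : MeasurePreserving (fun ω : Path E => ω u) (M.probChange A n) (M.stepLaw A) := by
      have := measurePreserving_eval_infinitePi
        (fun u : ℕ => M.stepLaw (if n ≤ u then A else ∅)) u
      simp only [hu, if_true] at this
      exact this
    have h := hmp.quasiMeasurePreserving.ae (p := fun x => M.lrProd A x ≠ 0 ∧ M.lrProd A x ≠ ∞)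
      ((ae_density_ne_zero (M.measurable_lrProd A) (stepLaw_eq_withDensity hac A)).and
        (ae_density_ne_top' (M.measurable_lrProd A) (stepLaw_eq_withDensity hac A)))
    filter_upwards [h] with ω hω _ using hω
  · exact ae_of_all _ fun ω h => absurd h hu

lemma measurable_sum_llrSum (A : Finset (Fin K)) (n t : ℕ) :
    Measurable[obsFiltration E t] fun ω : Path E => ∑ u ∈ Finset.Ico n t, M.llrSum A (ω u) :=
  Finset.measurable_fun_sum _ fun _ hu => (measurable_llrSum A).comp
    (measurable_obsFiltration_apply (Finset.mem_Ico.1 hu).2)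

/-- A stopping time that occurs at the latest when the likelihood ratio of the sensors in `A`
since some past instant exceeds `exp c` has a delay of at most `c / I_A + O(1)`. -/
lemma delay_le_of_potential (hac : ∀ k, M.postLaw k ≪ M.preLaw k) {A : Finset (Fin K)}
    {u : ℝ → ℝ≥0∞} (hu : Measurable u)
    (hstep : ∀ a, 0 < a → ∫⁻ x, u (a - M.llrSum A x) ∂(M.stepLaw A) + 1 ≤ u a)
    {T : Path E → ℕ∞} (hT : IsStoppingTime (obsFiltration E) T) {c : ℝ}
    (hc : ∀ ω (s t : ℕ), s ≤ t → (t : ℕ∞) < T ω →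
      ∏ r ∈ Finset.Ico s t, M.lrProd A (ω r) < ENNReal.ofReal (Real.exp c)) :
    M.delay A T ≤ u c := by
  refine iSup_le fun n => essSup_le_of_ae_le _ ?_
  refine condLExp_le_const (obsFiltration_le n) fun B hB => ?_
  set P := M.probChange A n with hP
  -- `Z t` is the distance the walk started at the change point still has to travel; before `T` it
  -- is positive, so `hstep` applies to it.
  set Z : ℕ → Path E → ℝ := fun t ω => c - ∑ r ∈ Finset.Ico n t, M.llrSum A (ω r) with hZ
  have hZm : ∀ t, Measurable[obsFiltration E t] (Z t) := fun t =>
    measurable_const.sub (measurable_sum_llrSum A n t)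
  set S : ℕ → Set (Path E) := fun t => B ∩ {ω | (t : ℕ∞) < T ω} with hS
  have hSm : ∀ t, n ≤ t → MeasurableSet[obsFiltration E t] (S t) := fun t ht =>
    MeasurableSet.inter ((obsFiltration E).mono ht _ hB) (measurableSet_natCast_lt hT t)
  have hpos : ∀ t, n ≤ t → ∀ᵐ ω ∂P, ω ∈ S t → 0 < Z t ω := fun t ht => by
    filter_upwards [ae_lrProd_ne hac A n] with ω hω hS
    have h1 := hc ω n t ht hS.2
    have h2 : 0 < (∏ r ∈ Finset.Ico n t, M.lrProd A (ω r)).toReal := by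
      refine ENNReal.toReal_pos ?_ (h1.trans ENNReal.ofReal_lt_top).ne
      exact Finset.prod_ne_zero_iff.2 fun r hr => (hω r (Finset.mem_Ico.1 hr).1).1
    have h3 := (ENNReal.lt_ofReal_iff_toReal_lt (h1.trans ENNReal.ofReal_lt_top).ne).1 h1
    have h4 := (Real.log_lt_iff_lt_exp h2).2 h3
    rw [ENNReal.toReal_prod, Real.log_prod (fun r hr => (ENNReal.toReal_pos
      (hω r (Finset.mem_Ico.1 hr).1).1 (hω r (Finset.mem_Ico.1 hr).1).2).ne')] at h4
    simpa [hZ, llrSum] using h4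
  have hone : ∀ t, n ≤ t →
      ∫⁻ ω in S (t + 1), u (Z (t + 1) ω) ∂P + P (S t) ≤ ∫⁻ ω in S t, u (Z t ω) ∂P := by
    intro t ht
    have hsub : S (t + 1) ⊆ S t := fun ω hω =>
      ⟨hω.1, lt_trans (b := ((t + 1 : ℕ) : ℕ∞)) (by exact_mod_cast Nat.lt_succ_self t) hω.2⟩
    have hG : Measurable fun q : ℝ × (∀ k, E k) => u (q.1 - M.llrSum A q.2) := by fun_prop
    have h1 : ∫⁻ ω in S t, u (Z t ω - M.llrSum A (ω t)) ∂P =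
        ∫⁻ ω in S t, ∫⁻ x, u (Z t ω - M.llrSum A x) ∂(M.stepLaw A) ∂P := by
      have := setLIntegral_eq_setLIntegral_lintegral_eval
        (fun r : ℕ => M.stepLaw (if n ≤ r then A else ∅)) (hZm t) (hSm t ht) hG
      simp only [ht, if_true] at this
      exact this
    have hSm' := obsFiltration_le t _ (hSm t ht)
    calc ∫⁻ ω in S (t + 1), u (Z (t + 1) ω) ∂P + P (S t)
        ≤ ∫⁻ ω in S t, u (Z t ω - M.llrSum A (ω t)) ∂P + ∫⁻ ω in S t, 1 ∂P := by
          rw [setLIntegral_one]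
          gcongr ?_ + _
          refine (lintegral_mono_set hsub).trans (le_of_eq (lintegral_congr fun ω => ?_))
          simp only [hZ, Finset.sum_Ico_succ_top ht, sub_sub]
      _ = ∫⁻ ω in S t, (∫⁻ x, u (Z t ω - M.llrSum A x) ∂(M.stepLaw A) + 1) ∂P := by
          rw [h1, lintegral_add_right _ measurable_const]
      _ ≤ ∫⁻ ω in S t, u (Z t ω) ∂P := by
          refine setLIntegral_mono_ae' hSm' ?_
          filter_upwards [hpos t ht] with ω hω hmem using hstep _ (hω hmem)
  -- Telescoping `hone` bounds the accumulated survival probabilities by the initial potential `u c`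
  -- on `B`, with no optional stopping theorem.
  have hsum : ∀ N : ℕ, ∑ i ∈ Finset.range N, P (S (n + i)) +
      ∫⁻ ω in S (n + N), u (Z (n + N) ω) ∂P ≤ u c * P B := by
    intro N
    induction N with
    | zero =>
      simp only [Finset.range_zero, Finset.sum_empty, zero_add, add_zero]
      refine (lintegral_mono_set Set.inter_subset_left).trans (le_of_eq ?_)
      simp [hZ]
    | succ N ih =>
      refine le_trans ?_ ih
      rw [Finset.sum_range_succ, add_assoc]
      gcongr
      rw [add_comm]
      exact hone (n + N) (by omega)
  have hB' := obsFiltration_le n _ hB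
  have hTm : ∀ t : ℕ, MeasurableSet {ω | (t : ℕ∞) < T ω} := fun t =>
    obsFiltration_le t _ (measurableSet_natCast_lt hT t)
  calc ∫⁻ ω in B, ((T ω : ℝ≥0∞) - (n : ℝ≥0∞)) ∂P = ∑' i, P (S (n + i)) := by
        simp_rw [ENat.toENNReal_sub_natCast_eq_tsum]
        rw [lintegral_tsum fun i => (Measurable.ite (hTm _) measurable_const
          measurable_const).aemeasurable]
        congr 1
        funext i
        have e : (fun ω : Path E => if ((n + i : ℕ) : ℕ∞) < T ω then (1 : ℝ≥0∞) else 0) =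
            {ω | ((n + i : ℕ) : ℕ∞) < T ω}.indicator 1 := by
          ext ω; simp [Set.indicator_apply]
        rw [e, lintegral_indicator_one (hTm _), Measure.restrict_apply (hTm _), Set.inter_comm]
    _ ≤ u c * P B := ENNReal.tsum_le_of_sum_range_le fun N => le_self_add.trans (hsum N)

end UpperBound

end SensorModel

/-! ### Integrating a conditional bound against weights known from the past. -/

section WeightedCondLExp

/-- The bound says that, on `m`, the measure with density `f` is at most `c • P`; integrate `w`
against both. -/
lemma lintegral_mul_le_of_condLExp_le {Ω : Type*} {m m0 : MeasurableSpace Ω} (hm : m ≤ m0)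
    {P : Measure Ω} [IsFiniteMeasure P] {f w : Ω → ℝ≥0∞} {c : ℝ≥0∞} (hf : Measurable f)
    (hw : Measurable[m] w) (h : ∀ᵐ ω ∂P, condLExp m P f ω ≤ c) :
    ∫⁻ ω, w ω * f ω ∂P ≤ c * ∫⁻ ω, w ω ∂P := by
  have hle : (P.withDensity f).trim hm ≤ (c • P).trim hm := by
    refine Measure.le_iff.2 fun B hB => ?_
    rw [trim_measurableSet_eq hm hB, trim_measurableSet_eq hm hB, withDensity_apply _ (hm _ hB),
      ← setLIntegral_condLExp hm P f hB, Measure.smul_apply, smul_eq_mul, ← setLIntegral_const]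
    exact lintegral_mono_ae (ae_restrict_of_ae h)
  calc ∫⁻ ω, w ω * f ω ∂P = ∫⁻ ω, w ω ∂(P.withDensity f) := by
        rw [lintegral_withDensity_eq_lintegral_mul _ hf (hw.mono hm le_rfl)]
        simp [mul_comm]
    _ ≤ ∫⁻ ω, w ω ∂(c • P) := by
        rw [← lintegral_trim hm hw, ← lintegral_trim hm hw]
        exact lintegral_mono' hle le_rfl
    _ = c * ∫⁻ ω, w ω ∂P := lintegral_smul_measure _ _

end WeightedCondLExp

/-! ### One-step drift of the square root and of the entropy along the CUSUM recursion. -/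

section EntropyPotential

/-- The Bregman distance between `x` and `d` for the function `x log x`. -/
noncomputable def entropyGap (d x : ℝ) : ℝ := x * Real.log x - x * (1 + Real.log d) + d

lemma entropyGap_nonneg {d x : ℝ} (hd : 0 < d) (hx : 0 ≤ x) : 0 ≤ entropyGap d x := by
  unfold entropyGap
  rcases hx.eq_or_lt with rfl | hx
  · simpa using hd.le
  · have h := Real.log_le_sub_one_of_pos (div_pos hd hx)
    rw [Real.log_div hd.ne' hx.ne'] at h
    have h2 := mul_le_mul_of_nonneg_left h hx.le
    have h3 : x * (d / x - 1) = d - x := by field_simp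
    nlinarith

@[fun_prop]
lemma measurable_entropyGap (d : ℝ) : Measurable (entropyGap d) := by
  unfold entropyGap; fun_prop

variable {X : Type*} [MeasurableSpace X] {μ ν : Measure X} {L : X → ℝ≥0∞}

/-- For `v ≥ 1`, the factor `ρ` removes at least `1 - ρ` from `√v ≥ 1`. For `v ≤ 1`, restarting at
one costs at most `1 - v`, since `√v ≥ v`. Summed up to `T`, this bounds the restart weights below
by a multiple of the mean time to false alarm. -/
lemma sqrt_drift (hL : Measurable L) {ρ : ℝ≥0∞} (hρ : ∫⁻ x, L x ^ (1 / 2 : ℝ) ∂μ = ρ)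
    (hρ1 : ρ ≤ 1) (v : ℝ≥0∞) :
    ∫⁻ x, (max v 1 * L x) ^ (1 / 2 : ℝ) ∂μ + (1 - ρ) ≤ v ^ (1 / 2 : ℝ) + (1 - v) := by
  have h1 : ∀ x, (max v 1 * L x) ^ (1 / 2 : ℝ) = max v 1 ^ (1 / 2 : ℝ) * L x ^ (1 / 2 : ℝ) :=
    fun x => ENNReal.mul_rpow_of_nonneg _ _ (by norm_num)
  simp_rw [h1]
  rw [lintegral_const_mul _ (by fun_prop), hρ]
  rcases le_total 1 v with h | h
  · rw [max_eq_left h, tsub_eq_zero_of_le h, add_zero]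
    have h2 : (1 : ℝ≥0∞) ≤ v ^ (1 / 2 : ℝ) := ENNReal.one_le_rpow h (by norm_num)
    calc v ^ (1 / 2 : ℝ) * ρ + (1 - ρ) ≤ v ^ (1 / 2 : ℝ) * ρ + v ^ (1 / 2 : ℝ) * (1 - ρ) := by
          gcongr
          exact le_mul_of_one_le_left' h2
      _ = v ^ (1 / 2 : ℝ) := by rw [← mul_add, add_tsub_cancel_of_le hρ1, mul_one]
  · rw [max_eq_right h, ENNReal.one_rpow, one_mul, add_tsub_cancel_of_le hρ1]
    calc (1 : ℝ≥0∞) = v + (1 - v) := (add_tsub_cancel_of_le h).symm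
      _ ≤ _ := by
        gcongr
        calc v = v ^ (1 : ℝ) := by simp
          _ ≤ _ := ENNReal.rpow_le_rpow_of_exponent_ge h (by norm_num)

variable [IsProbabilityMeasure μ] [IsProbabilityMeasure ν]

/-- Expand the logarithm and use `∫ L dμ = 1` and `∫ L log L dμ = ∫ log L dν`. -/
lemma lintegral_entropyGap_mul (hL : Measurable L) (hν : ν = μ.withDensity L)
    (hint : Integrable (fun x => Real.log (L x).toReal) ν) {d m : ℝ} (hd : 0 < d) (hm : 0 < m) :
    ∫⁻ x, ENNReal.ofReal (entropyGap d (m * (L x).toReal)) ∂μ =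
      ENNReal.ofReal (m * Real.log m + m * ∫ x, Real.log (L x).toReal ∂ν -
        m * (1 + Real.log d) + d) := by
  have hlt : ∀ᵐ x ∂μ, L x < ∞ := (ae_density_ne_top hL hν).mono fun x hx => hx.lt_top
  have i1 : Integrable (fun x => (L x).toReal) μ :=
    integrable_toReal_of_lintegral_ne_top hL.aemeasurable (by simp [lintegral_density_eq_one hν])
  have e1 : ∫ x, (L x).toReal ∂μ = 1 := by
    rw [integral_toReal hL.aemeasurable hlt, lintegral_density_eq_one hν, ENNReal.toReal_one]
  have i2 : Integrable (fun x => (L x).toReal * Real.log (L x).toReal) μ := by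
    rw [hν, integrable_withDensity_iff_integrable_smul' hL hlt] at hint
    simpa using hint
  have e2 : ∫ x, (L x).toReal * Real.log (L x).toReal ∂μ = ∫ x, Real.log (L x).toReal ∂ν := by
    conv_rhs => rw [hν]
    rw [integral_withDensity_eq_integral_toReal_smul hL hlt]
    simp
  have hfun : ∀ x, entropyGap d (m * (L x).toReal) =
      m * ((L x).toReal * Real.log (L x).toReal) +
        (m * Real.log m - m * (1 + Real.log d)) * (L x).toReal + d := fun x => by
    unfold entropyGap
    by_cases h0 : (L x).toReal = 0
    · simp [h0]
    · rw [Real.log_mul hm.ne' h0]; ring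
  have i3 := ((i2.const_mul m).add (i1.const_mul (m * Real.log m - m * (1 + Real.log d)))).add
    (integrable_const d)
  rw [← ofReal_integral_eq_lintegral_ofReal]
  · congr 1
    simp_rw [hfun]
    have j1 := integral_add ((i2.const_mul m).add
      (i1.const_mul (m * Real.log m - m * (1 + Real.log d)))) (integrable_const d)
    have j2 := integral_add (i2.const_mul m)
      (i1.const_mul (m * Real.log m - m * (1 + Real.log d)))
    simp only [Pi.add_apply] at j1
    rw [j1, j2, integral_const_mul, integral_const_mul, e1, e2]
    simp
    ring
  · simp_rw [hfun]
    exact i3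
  · exact ae_of_all _ fun x => entropyGap_nonneg hd (mul_nonneg hm.le ENNReal.toReal_nonneg)

/-- For finite `v ≥ 1` the entropy term grows in mean by the information times `v`, while the linear
term keeps its mean. For `v ≤ 1` the step starts from one, and the slack is `v log v - v + 1`, that
is `entropyGap 1 v ≥ 0`. -/
lemma entropyGap_drift (hL : Measurable L) (hν : ν = μ.withDensity L)
    (hint : Integrable (fun x => Real.log (L x).toReal) ν)
    (hI : 0 < ∫ x, Real.log (L x).toReal ∂ν) {d : ℝ} (hd : 1 ≤ d) (v : ℝ≥0∞) :
    ∫⁻ x, ENNReal.ofReal (entropyGap d (max v 1 * L x).toReal) ∂μ +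
        ENNReal.ofReal (Real.log d) * (1 - v) ≤
      ENNReal.ofReal (entropyGap d v.toReal) +
        ENNReal.ofReal (∫ x, Real.log (L x).toReal ∂ν) * max v 1 := by
  set I := ∫ x, Real.log (L x).toReal ∂ν
  have hd0 : 0 < d := by linarith
  by_cases hv : v = ∞
  · have : ENNReal.ofReal I ≠ 0 := (ENNReal.ofReal_pos.2 hI).ne'
    simp [hv, ENNReal.mul_top this]
  lift v to NNReal using hv
  set a : ℝ := NNReal.toReal v with ha
  have ha0 : 0 ≤ a := v.coe_nonneg
  have hva : (v : ℝ≥0∞) = ENNReal.ofReal a := (ENNReal.ofReal_coe_nnreal).symm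
  have hm : 0 < max a 1 := lt_max_of_lt_right one_pos
  have hmax : max (v : ℝ≥0∞) 1 = ENNReal.ofReal (max a 1) := by
    rw [ENNReal.ofReal_max, ← hva, ENNReal.ofReal_one]
  have h1 : ∀ x, (max (v : ℝ≥0∞) 1 * L x).toReal = max a 1 * (L x).toReal := fun x => by
    rw [hmax, ENNReal.toReal_mul, ENNReal.toReal_ofReal hm.le]
  have hsub : (1 : ℝ≥0∞) - v = ENNReal.ofReal (max (1 - a) 0) := by
    rw [hva, ← ENNReal.ofReal_one, ← ENNReal.ofReal_sub _ ha0]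
    simp
  simp_rw [h1]
  have hnn : 0 ≤ max a 1 * Real.log (max a 1) + max a 1 * I - max a 1 * (1 + Real.log d) + d := by
    have h3 := entropyGap_nonneg hd0 hm.le
    unfold entropyGap at h3
    nlinarith [mul_pos hm hI]
  have hlog := Real.log_nonneg hd
  rw [lintegral_entropyGap_mul hL hν hint hd0 hm, hsub, hmax, ENNReal.coe_toReal,
    ← ENNReal.ofReal_mul hlog, ← ENNReal.ofReal_mul hI.le,
    ← ENNReal.ofReal_add hnn (mul_nonneg hlog (le_max_right _ _)),
    ← ENNReal.ofReal_add (entropyGap_nonneg hd0 ha0) (mul_nonneg hI.le hm.le)]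
  refine ENNReal.ofReal_le_ofReal ?_
  rcases le_total 1 a with h | h
  · rw [max_eq_left h, max_eq_right (by linarith : 1 - a ≤ 0)]
    unfold entropyGap
    nlinarith
  · rw [max_eq_right h, max_eq_left (by linarith : 0 ≤ 1 - a)]
    have h3 := entropyGap_nonneg one_pos ha0
    unfold entropyGap at h3 ⊢
    simp only [Real.log_one] at h3 ⊢
    nlinarith

end EntropyPotential

namespace SensorModel

/-! ### Lower bound on the worst-case delay of an arbitrary rule. -/

section LowerBound

variable {K : ℕ} {E : Fin K → Type*} [∀ k, MeasurableSpace (E k)]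

/-- The CUSUM statistic of the sensors in `A`, on the likelihood ratio scale. -/
noncomputable def cusum (M : SensorModel E) (A : Finset (Fin K)) : ℕ → Path E → ℝ≥0∞
  | 0, _ => 0
  | t + 1, ω => max (cusum M A t ω) 1 * M.lrProd A (ω t)

variable {M : SensorModel E}

lemma measurable_cusum (A : Finset (Fin K)) (t : ℕ) :
    Measurable[obsFiltration E t] (M.cusum A t) := by
  induction t with
  | zero => exact measurable_const
  | succ t ih =>
    have h1 : Measurable[obsFiltration E (t + 1)] (M.cusum A t) :=
      ih.mono ((obsFiltration E).mono (Nat.le_succ t)) le_rfl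
    exact (h1.max measurable_const).mul
      ((M.measurable_lrProd A).comp (measurable_obsFiltration_apply (Nat.lt_succ_self t)))

/-- Unrolls the CUSUM recursion through `max v 1 = v + (1 - v)^+`: each instant `n` injects the mass
`(1 - V_n)^+`, which the likelihood ratio then transports. -/
lemma max_cusum_one_eq_sum (A : Finset (Fin K)) (t : ℕ) (ω : Path E) :
    max (M.cusum A t ω) 1 = ∑ n ∈ Finset.range (t + 1),
      (1 - M.cusum A n ω) * ∏ r ∈ Finset.Ico n t, M.lrProd A (ω r) := by
  have hmax : ∀ v : ℝ≥0∞, max v 1 = v + (1 - v) := fun v => add_tsub_eq_max.symm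
  induction t with
  | zero => simp [cusum]
  | succ t ih =>
    rw [Finset.sum_range_succ, Finset.Ico_self, Finset.prod_empty, mul_one, hmax]
    congr 1
    rw [cusum, ih, Finset.sum_mul]
    refine Finset.sum_congr rfl fun n hn => ?_
    rw [Finset.prod_Ico_succ_top (Nat.lt_succ_iff.1 (Finset.mem_range.1 hn)), mul_assoc]

/-- Summing a one-step drift inequality along the CUSUM statistic up to a stopping time. -/
lemma sum_setLIntegral_cusum_le (A : Finset (Fin K)) {T : Path E → ℕ∞}
    (hT : IsStoppingTime (obsFiltration E) T) {f α β : ℝ≥0∞ → ℝ≥0∞} (hf : Measurable f)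
    (hα : Measurable α)
    (h : ∀ v, ∫⁻ x, f (max v 1 * M.lrProd A x) ∂(M.stepLaw ∅) + α v ≤ f v + β v) (n : ℕ) :
    ∑ t ∈ Finset.range n, ∫⁻ ω in {ω | (t : ℕ∞) < T ω}, α (M.cusum A t ω) ∂M.probInf ≤
      f 0 + ∑ t ∈ Finset.range n,
        ∫⁻ ω in {ω | (t : ℕ∞) < T ω}, β (M.cusum A t ω) ∂M.probInf := by
  set S : ℕ → Set (Path E) := fun t => {ω | (t : ℕ∞) < T ω} with hS
  have hfm : ∀ t, Measurable[obsFiltration E t] fun ω => f (M.cusum A t ω) := fun t =>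
    hf.comp (measurable_cusum A t)
  have hone : ∀ t, ∫⁻ ω in S (t + 1), f (M.cusum A (t + 1) ω) ∂M.probInf +
      ∫⁻ ω in S t, α (M.cusum A t ω) ∂M.probInf ≤
      ∫⁻ ω in S t, f (M.cusum A t ω) ∂M.probInf +
        ∫⁻ ω in S t, β (M.cusum A t ω) ∂M.probInf := by
    intro t
    have hsub : S (t + 1) ⊆ S t := fun ω hω =>
      lt_trans (b := ((t + 1 : ℕ) : ℕ∞)) (by exact_mod_cast Nat.lt_succ_self t) hω
    have hG : Measurable fun q : ℝ≥0∞ × (∀ k, E k) => f (max q.1 1 * M.lrProd A q.2) := by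
      fun_prop
    have h1 : ∫⁻ ω in S t, f (M.cusum A (t + 1) ω) ∂M.probInf =
        ∫⁻ ω in S t, ∫⁻ x, f (max (M.cusum A t ω) 1 * M.lrProd A x) ∂(M.stepLaw ∅) ∂M.probInf :=
      setLIntegral_eq_setLIntegral_lintegral_eval (fun _ : ℕ => M.stepLaw ∅)
        (measurable_cusum A t) (measurableSet_natCast_lt hT t) hG
    have hαm : Measurable fun ω => α (M.cusum A t ω) :=
      (hα.comp (measurable_cusum A t)).mono (obsFiltration_le t) le_rfl
    calc _ ≤ ∫⁻ ω in S t, f (M.cusum A (t + 1) ω) ∂M.probInf +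
          ∫⁻ ω in S t, α (M.cusum A t ω) ∂M.probInf := by
          gcongr
      _ = ∫⁻ ω in S t, (∫⁻ x, f (max (M.cusum A t ω) 1 * M.lrProd A x) ∂(M.stepLaw ∅) +
          α (M.cusum A t ω)) ∂M.probInf := by
          rw [h1, lintegral_add_right _ hαm]
      _ ≤ ∫⁻ ω in S t, (f (M.cusum A t ω) + β (M.cusum A t ω)) ∂M.probInf :=
          lintegral_mono fun ω => h _
      _ = _ := lintegral_add_left ((hfm t).mono (obsFiltration_le t) le_rfl) _
  have hsum : ∑ t ∈ Finset.range n, ∫⁻ ω in S t, α (M.cusum A t ω) ∂M.probInf +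
      ∫⁻ ω in S n, f (M.cusum A n ω) ∂M.probInf ≤
      f 0 + ∑ t ∈ Finset.range n, ∫⁻ ω in S t, β (M.cusum A t ω) ∂M.probInf := by
    induction n with
    | zero =>
      simp only [Finset.range_zero, Finset.sum_empty, zero_add, add_zero, cusum]
      rw [setLIntegral_const]
      exact mul_le_of_le_one_right' prob_le_one
    | succ n ih =>
      rw [Finset.sum_range_succ, Finset.sum_range_succ]
      calc _ = ∑ t ∈ Finset.range n, ∫⁻ ω in S t, α (M.cusum A t ω) ∂M.probInf +
            (∫⁻ ω in S (n + 1), f (M.cusum A (n + 1) ω) ∂M.probInf +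
              ∫⁻ ω in S n, α (M.cusum A n ω) ∂M.probInf) := by ring
        _ ≤ ∑ t ∈ Finset.range n, ∫⁻ ω in S t, α (M.cusum A t ω) ∂M.probInf +
            (∫⁻ ω in S n, f (M.cusum A n ω) ∂M.probInf +
              ∫⁻ ω in S n, β (M.cusum A n ω) ∂M.probInf) :=
              add_le_add_right (hone n) _
        _ = ∑ t ∈ Finset.range n, ∫⁻ ω in S t, α (M.cusum A t ω) ∂M.probInf +
            ∫⁻ ω in S n, f (M.cusum A n ω) ∂M.probInf +
              ∫⁻ ω in S n, β (M.cusum A n ω) ∂M.probInf := by ring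
        _ ≤ _ := by rw [← add_assoc]; gcongr
  exact le_self_add.trans hsum

lemma measurable_toENNReal_of_isStoppingTime {T : Path E → ℕ∞}
    (hT : IsStoppingTime (obsFiltration E) T) : Measurable fun ω => (T ω : ℝ≥0∞) := by
  have e : (fun ω => (T ω : ℝ≥0∞)) = fun ω => ∑' i : ℕ, if (i : ℕ∞) < T ω then 1 else 0 := by
    funext ω
    simpa using ENat.toENNReal_sub_natCast_eq_tsum (T ω) 0
  rw [e]
  exact Measurable.tsum fun i => Measurable.ite
    (obsFiltration_le i _ (measurableSet_natCast_lt hT i)) measurable_const measurable_const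

lemma lintegral_eq_tsum_measure_lt {T : Path E → ℕ∞} (hT : IsStoppingTime (obsFiltration E) T)
    (P : Measure (Path E)) :
    ∫⁻ ω, (T ω : ℝ≥0∞) ∂P = ∑' t : ℕ, P {ω | (t : ℕ∞) < T ω} := by
  have hm : ∀ t : ℕ, MeasurableSet {ω | (t : ℕ∞) < T ω} := fun t =>
    obsFiltration_le t _ (measurableSet_natCast_lt hT t)
  have e : ∀ ω, (T ω : ℝ≥0∞) = ∑' t : ℕ, {ω | (t : ℕ∞) < T ω}.indicator 1 ω := fun ω => by
    simpa [Set.indicator_apply] using ENat.toENNReal_sub_natCast_eq_tsum (T ω) 0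
  simp_rw [e]
  rw [lintegral_tsum fun t => (measurable_one.indicator (hm t)).aemeasurable]
  simp_rw [lintegral_indicator_one (hm _)]

/-- The worst-case delay bounds the accumulated CUSUM statistic by the accumulated weights of the
restarts. -/
lemma sum_setLIntegral_max_cusum_le (hac : ∀ k, M.postLaw k ≪ M.preLaw k) (A : Finset (Fin K))
    {T : Path E → ℕ∞} (hT : IsStoppingTime (obsFiltration E) T) (N : ℕ) :
    ∑ t ∈ Finset.range N, ∫⁻ ω in {ω | (t : ℕ∞) < T ω}, max (M.cusum A t ω) 1 ∂M.probInf ≤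
      M.delay A T * ∑ t ∈ Finset.range N,
        ∫⁻ ω in {ω | (t : ℕ∞) < T ω}, (1 - M.cusum A t ω) ∂M.probInf := by
  set S : ℕ → Set (Path E) := fun t => {ω | (t : ℕ∞) < T ω} with hS
  have hSm : ∀ t, MeasurableSet[obsFiltration E t] (S t) := measurableSet_natCast_lt hT
  have hSm' : ∀ t, MeasurableSet (S t) := fun t => obsFiltration_le t _ (hSm t)
  have hw : ∀ n, Measurable[obsFiltration E n] fun ω => 1 - M.cusum A n ω := fun n =>
    measurable_const.sub (measurable_cusum A n)
  have hw' : ∀ n, Measurable fun ω => 1 - M.cusum A n ω := fun n =>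
    (hw n).mono (obsFiltration_le n) le_rfl
  -- The likelihood ratio over `[n, t)` turns `P_∞` into `P_n^A` on the past before `t`.
  have hchange : ∀ n t, n ≤ t → ∫⁻ ω in S t, (1 - M.cusum A n ω) *
      ∏ r ∈ Finset.Ico n t, M.lrProd A (ω r) ∂M.probInf =
      ∫⁻ ω in S t, (1 - M.cusum A n ω) ∂(M.probChange A n) := by
    intro n t hnt
    have hF : Measurable[obsFiltration E t] ((S t).indicator fun ω => 1 - M.cusum A n ω) :=
      Measurable.indicator (m := obsFiltration E t)
        ((hw n).mono ((obsFiltration E).mono hnt) le_rfl) (hSm t)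
    have h := lintegral_infinitePi_eq_lintegral_mul_prod (fun _ : ℕ => M.stepLaw ∅)
      (M.measurable_lrProd A) (fun r : ℕ => M.stepLaw (if n ≤ r then A else ∅)) (s := n) (t := t)
      (fun r hr _ => by rw [if_pos hr]; exact stepLaw_eq_withDensity hac A)
      (fun r hr _ => by rw [if_neg (not_le.2 hr)]) hF
    rw [← lintegral_indicator (hSm' t), ← lintegral_indicator (hSm' t)]
    refine Eq.trans (lintegral_congr fun ω => ?_) h.symm
    by_cases hω : ω ∈ S t <;> simp [hω]
  have hagree : ∀ n, ∫⁻ ω in S n, (1 - M.cusum A n ω) ∂(M.probChange A n) =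
      ∫⁻ ω in S n, (1 - M.cusum A n ω) ∂M.probInf := fun n => by
    rw [← hchange n n le_rfl]; simp
  -- Summing the survival indicators over `t ≥ n` gives at most `(T - n)^+`. The weight, cut off on
  -- `{T ≤ n}`, is known at time `n`, so the conditional delay bound can be integrated against it.
  have hinner : ∀ n, ∑ t ∈ Finset.Ico n N, ∫⁻ ω in S t, (1 - M.cusum A n ω) ∂(M.probChange A n) ≤
      M.delay A T * ∫⁻ ω in S n, (1 - M.cusum A n ω) ∂M.probInf := by
    intro n
    have hcond : ∀ᵐ ω ∂(M.probChange A n), condLExp (obsFiltration E n) (M.probChange A n)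
        (fun ω => (T ω : ℝ≥0∞) - (n : ℝ≥0∞)) ω ≤ M.delay A T := by
      filter_upwards [ae_le_essSup (μ := M.probChange A n) (f := condLExp (obsFiltration E n)
        (M.probChange A n) fun ω => (T ω : ℝ≥0∞) - (n : ℝ≥0∞))] with ω hω
      exact hω.trans (le_iSup (fun n : ℕ => essSup (condLExp (obsFiltration E n)
        (M.probChange A n) fun ω => (T ω : ℝ≥0∞) - (n : ℝ≥0∞)) (M.probChange A n)) n)
    have hF : Measurable[obsFiltration E n] ((S n).indicator fun ω => 1 - M.cusum A n ω) :=
      Measurable.indicator (m := obsFiltration E n) (hw n) (hSm n)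
    have hTm : Measurable fun ω => (T ω : ℝ≥0∞) - (n : ℝ≥0∞) :=
      (measurable_toENNReal_of_isStoppingTime hT).sub measurable_const
    have h := lintegral_mul_le_of_condLExp_le (obsFiltration_le n) hTm hF hcond
    rw [lintegral_indicator (hSm' n), hagree] at h
    refine le_trans ?_ h
    simp_rw [← lintegral_indicator (hSm' _)]
    rw [← lintegral_finsetSum _ fun t _ => (hw' n).indicator (hSm' t)]
    refine lintegral_mono fun ω => ?_
    simp only
    rw [Finset.sum_Ico_eq_sum_range, ENat.toENNReal_sub_natCast_eq_tsum, ← ENNReal.tsum_mul_left]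
    refine le_trans (Finset.sum_le_sum fun i _ => ?_) (ENNReal.sum_le_tsum (Finset.range (N - n)))
    by_cases hi : ω ∈ S (n + i)
    · have hn : ω ∈ S n := lt_of_le_of_lt (b := ((n + i : ℕ) : ℕ∞))
        (by exact_mod_cast Nat.le_add_right n i) hi
      rw [Set.indicator_of_mem hi, Set.indicator_of_mem hn, if_pos (show ((n + i : ℕ) : ℕ∞) < T ω from hi), mul_one]
    · rw [Set.indicator_of_notMem hi]
      exact zero_le
  calc ∑ t ∈ Finset.range N, ∫⁻ ω in S t, max (M.cusum A t ω) 1 ∂M.probInf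
      = ∑ t ∈ Finset.range N, ∑ n ∈ Finset.range (t + 1),
          ∫⁻ ω in S t, (1 - M.cusum A n ω) ∂(M.probChange A n) := by
        refine Finset.sum_congr rfl fun t _ => ?_
        simp_rw [max_cusum_one_eq_sum A t]
        have hprod : ∀ n, Measurable fun ω : Path E =>
            ∏ r ∈ Finset.Ico n t, M.lrProd A (ω r) := fun n =>
          Finset.measurable_fun_prod _ fun r _ => (M.measurable_lrProd A).comp
            (measurable_pi_apply r)
        rw [lintegral_finsetSum' _ fun n _ => ((hw' n).fun_mul (hprod n)).aemeasurable]
        exact Finset.sum_congr rfl fun n hn =>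
          hchange n t (Nat.lt_succ_iff.1 (Finset.mem_range.1 hn))
    _ = ∑ n ∈ Finset.range N, ∑ t ∈ Finset.Ico n N,
          ∫⁻ ω in S t, (1 - M.cusum A n ω) ∂(M.probChange A n) := by
        refine Finset.sum_comm' fun t n => ?_
        simp only [Finset.mem_range, Finset.mem_Ico]
        omega
    _ ≤ ∑ n ∈ Finset.range N, M.delay A T * ∫⁻ ω in S n, (1 - M.cusum A n ω) ∂M.probInf :=
        Finset.sum_le_sum fun n _ => hinner n
    _ = _ := by rw [Finset.mul_sum]

/-- Any rule with mean time to false alarm at least `γ` has a worst-case delay of at least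
`log γ / I_A - O(1)`. -/
lemma le_delay_of_mem_rulesClass (hI : ∀ k, 0 < M.localKL k ∧ M.localKL k ≠ ∞)
    {A : Finset (Fin K)} (hA : A.Nonempty) :
    ∃ C : ℝ, ∀ γ : ℝ, 0 < γ → ∀ T ∈ M.rulesClass γ,
      ENNReal.ofReal (Real.log γ / M.info A - C) ≤ M.delay A T := by
  have hac : ∀ k, M.postLaw k ≪ M.preLaw k := fun k =>
    (InformationTheory.klDiv_ne_top_iff.1 (hI k).2).1
  have hL := M.measurable_lrProd A
  have hν := stepLaw_eq_withDensity hac A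
  obtain ⟨hint, hinfo⟩ := integrable_llrSum (fun k => (hI k).2) A
  have hpos : 0 < M.info A := info_pos hI hA
  set I := M.info A with hIdef
  set ρ := ∫⁻ x, M.lrProd A x ^ (1 / 2 : ℝ) ∂(M.stepLaw ∅) with hρ
  have hρ1 : ρ < 1 := lintegral_sqrt_density_lt_one hL hν (by
    change ∫ x, M.llrSum A x ∂(M.stepLaw A) ≠ 0
    rw [hinfo]; exact hpos.ne')
  set κ : ℝ := (1 - ρ).toReal with hκ
  have hκt : 1 - ρ ≠ ∞ := ENNReal.sub_ne_top ENNReal.one_ne_top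
  have hκ0 : 0 < κ := ENNReal.toReal_pos (tsub_pos_of_lt hρ1).ne' hκt
  have hκe : 1 - ρ = ENNReal.ofReal κ := (ENNReal.ofReal_toReal hκt).symm
  refine ⟨(1 - Real.log (κ / 2)) / I, fun γ hγ T hTγ => ?_⟩
  obtain ⟨hT, hET⟩ := hTγ
  -- The factor `1 / 2` pays for truncating at a finite `N`, which keeps `D` finite so that it can
  -- be cancelled. If `d < 1` the claimed bound is nonpositive.
  set d : ℝ := κ / 2 * γ with hd
  have hd0 : 0 < d := by positivity
  have elog : Real.log γ / I - (1 - Real.log (κ / 2)) / I = (Real.log d - 1) / I := by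
    rw [hd, Real.log_mul (by positivity) hγ.ne']; ring
  rw [elog]
  rcases lt_or_ge d 1 with hd1 | hd1
  · rw [ENNReal.ofReal_of_nonpos]
    · exact zero_le
    · exact div_nonpos_of_nonpos_of_nonneg (by linarith [Real.log_nonpos hd0.le hd1.le]) hpos.le
  rw [lintegral_eq_tsum_measure_lt hT] at hET
  have hlt : ENNReal.ofReal (γ / 2) < ∑' t : ℕ, M.probInf {ω | (t : ℕ∞) < T ω} :=
    ((ENNReal.ofReal_lt_ofReal_iff hγ).2 (by linarith)).trans_le hET
  rw [ENNReal.tsum_eq_iSup_nat, lt_iSup_iff] at hlt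
  obtain ⟨N, hN⟩ := hlt
  set D := ∑ t ∈ Finset.range N,
    ∫⁻ ω in {ω | (t : ℕ∞) < T ω}, (1 - M.cusum A t ω) ∂M.probInf with hDdef
  have hDd : ENNReal.ofReal d ≤ D := by
    have h := sum_setLIntegral_cusum_le (M := M) A hT (f := fun v => v ^ (1 / 2 : ℝ))
      (α := fun _ => 1 - ρ) (β := fun v => 1 - v) (by fun_prop) measurable_const
      (sqrt_drift hL hρ.symm hρ1.le) N
    simp only [setLIntegral_const, ← Finset.mul_sum] at h
    rw [ENNReal.zero_rpow_of_pos (by norm_num), zero_add] at h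
    refine le_trans ?_ h
    rw [hκe, hd, show κ / 2 * γ = κ * (γ / 2) by ring, ENNReal.ofReal_mul hκ0.le]
    gcongr
  have hDt : D ≠ ∞ := by
    refine (ENNReal.sum_lt_top.2 fun t _ => ?_).ne
    calc _ ≤ ∫⁻ ω in {ω | (t : ℕ∞) < T ω}, 1 ∂M.probInf := lintegral_mono fun ω => tsub_le_self
      _ ≤ 1 := by rw [setLIntegral_one]; exact prob_le_one
      _ < ∞ := ENNReal.one_lt_top
  have hD0 : D ≠ 0 := ((ENNReal.ofReal_pos.2 hd0).trans_le hDd).ne'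
  have hdrift := entropyGap_drift hL hν hint (by
    change 0 < ∫ x, M.llrSum A x ∂(M.stepLaw A)
    rw [hinfo]; exact hpos) hd1
  have hinfo' : ∫ x, Real.log (M.lrProd A x).toReal ∂(M.stepLaw A) = I := hinfo
  rw [hinfo'] at hdrift
  have h := sum_setLIntegral_cusum_le (M := M) A hT
    (f := fun v => ENNReal.ofReal (entropyGap d v.toReal))
    (α := fun v => ENNReal.ofReal (Real.log d) * (1 - v))
    (β := fun v => ENNReal.ofReal I * max v 1) (by fun_prop) (by fun_prop) hdrift N
  simp_rw [lintegral_const_mul' _ _ ENNReal.ofReal_ne_top] at h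
  rw [← Finset.mul_sum, ← Finset.mul_sum] at h
  have hgap0 : entropyGap d (0 : ℝ≥0∞).toReal = d := by simp [entropyGap]
  rw [hgap0] at h
  -- The initial potential is `d`, and `d ≤ D` absorbs it into the term `1 * D`.
  have h2 : ENNReal.ofReal (Real.log d) * D ≤ (1 + ENNReal.ofReal I * M.delay A T) * D := by
    calc _ ≤ _ := h
      _ ≤ D + ENNReal.ofReal I * (M.delay A T * D) := by
        gcongr
        exact sum_setLIntegral_max_cusum_le hac A hT N
      _ = _ := by ring
  have h3 := (ENNReal.mul_le_mul_iff_left hD0 hDt).1 h2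
  rw [ENNReal.ofReal_div_of_pos hpos, ENNReal.div_le_iff' (ENNReal.ofReal_pos.2 hpos).ne'
    ENNReal.ofReal_ne_top, ENNReal.ofReal_sub _ zero_le_one, ENNReal.ofReal_one]
  exact tsub_le_iff_left.2 h3

end LowerBound

end SensorModel

namespace SensorModel

/-! ### Mean time to false alarm through Shiryaev-Roberts statistics. -/

section FalseAlarm

variable {K : ℕ} {E : Fin K → Type*} [∀ k, MeasurableSpace (E k)]

/-- The Shiryaev-Roberts statistic of the sensors in `B`. -/
noncomputable def shiryaevRoberts (M : SensorModel E) (B : Finset (Fin K)) : ℕ → Path E → ℝ≥0∞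
  | 0, _ => 0
  | t + 1, ω => (shiryaevRoberts M B t ω + 1) * M.lrProd B (ω t)

variable {M : SensorModel E}

lemma measurable_shiryaevRoberts (B : Finset (Fin K)) (t : ℕ) :
    Measurable[obsFiltration E t] (M.shiryaevRoberts B t) := by
  induction t with
  | zero => exact measurable_const
  | succ t ih =>
    have h1 : Measurable[obsFiltration E (t + 1)] (M.shiryaevRoberts B t) :=
      ih.mono ((obsFiltration E).mono (Nat.le_succ t)) le_rfl
    exact (h1.add measurable_const).mul
      ((M.measurable_lrProd B).comp (measurable_obsFiltration_apply (Nat.lt_succ_self t)))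

/-- The window product is one term of the unrolled recursion. The empty window `s = t` is not among
these terms, hence `s < t`. -/
lemma prod_lrProd_le_shiryaevRoberts (B : Finset (Fin K)) {s t : ℕ} (hst : s < t) (ω : Path E) :
    ∏ r ∈ Finset.Ico s t, M.lrProd B (ω r) ≤ M.shiryaevRoberts B t ω := by
  induction t with
  | zero => omega
  | succ t ih =>
    rw [Finset.prod_Ico_succ_top (Nat.lt_succ_iff.1 hst), shiryaevRoberts]
    gcongr
    rcases (Nat.lt_succ_iff.1 hst).eq_or_lt with rfl | h
    · simp
    · exact (ih h).trans le_self_add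

/-- A weighted Shiryaev-Roberts statistic with total weight `W` that reaches the level `c` whenever
the rule stops bounds the mean time to false alarm from below by `c / W`. -/
lemma le_mul_lintegral_of_le_shiryaevRoberts (hac : ∀ k, M.postLaw k ≪ M.preLaw k)
    {T : Path E → ℕ∞} (hT : IsStoppingTime (obsFiltration E) T) (hT0 : ∀ ω, 0 < T ω)
    (w : Finset (Fin K) → ℝ≥0∞) (hw : ∑ B, w B ≠ 0) {c : ℝ≥0∞} (hc : c ≠ ∞)
    (h : ∀ ω (t : ℕ), T ω = t → c ≤ ∑ B, w B * M.shiryaevRoberts B t ω) :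
    c ≤ (∑ B, w B) * ∫⁻ ω, (T ω : ℝ≥0∞) ∂M.probInf := by
  set S : ℕ → Set (Path E) := fun t => {ω | (t : ℕ∞) < T ω} with hS
  have hSm : ∀ t, MeasurableSet[obsFiltration E t] (S t) := measurableSet_natCast_lt hT
  have hSm' : ∀ t, MeasurableSet (S t) := fun t => obsFiltration_le t _ (hSm t)
  set R : ℕ → Path E → ℝ≥0∞ := fun t ω => ∑ B, w B * M.shiryaevRoberts B t ω with hR
  have hsr : ∀ B t, Measurable (M.shiryaevRoberts B t) := fun B t =>
    (measurable_shiryaevRoberts B t).mono (obsFiltration_le t) le_rfl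
  have hstep : ∀ t, ∫⁻ ω in S t, R (t + 1) ω ∂M.probInf =
      ∫⁻ ω in S t, R t ω ∂M.probInf + (∑ B, w B) * M.probInf (S t) := by
    intro t
    have hB : ∀ B, ∫⁻ ω in S t, M.shiryaevRoberts B (t + 1) ω ∂M.probInf =
        ∫⁻ ω in S t, M.shiryaevRoberts B t ω ∂M.probInf + M.probInf (S t) := by
      intro B
      have hG : Measurable fun q : ℝ≥0∞ × (∀ k, E k) => (q.1 + 1) * M.lrProd B q.2 := by fun_prop
      have h1 : ∫⁻ ω in S t, M.shiryaevRoberts B (t + 1) ω ∂M.probInf =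
          ∫⁻ ω in S t, ∫⁻ x, (M.shiryaevRoberts B t ω + 1) * M.lrProd B x ∂(M.stepLaw ∅)
            ∂M.probInf :=
        setLIntegral_eq_setLIntegral_lintegral_eval (fun _ : ℕ => M.stepLaw ∅)
          (measurable_shiryaevRoberts B t) (hSm t) hG
      simp_rw [lintegral_const_mul _ (M.measurable_lrProd B),
        lintegral_density_eq_one (stepLaw_eq_withDensity hac B), mul_one] at h1
      rw [h1, lintegral_add_right _ measurable_const, setLIntegral_one]
    simp only [hR]
    rw [lintegral_finsetSum _ fun B _ => (hsr B (t + 1)).const_mul _,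
      lintegral_finsetSum _ fun B _ => (hsr B t).const_mul _, Finset.sum_mul,
      ← Finset.sum_add_distrib]
    refine Finset.sum_congr rfl fun B _ => ?_
    rw [lintegral_const_mul _ (hsr B (t + 1)), lintegral_const_mul _ (hsr B t), hB, mul_add]
  -- Truncated optional stopping: stopped paths contribute at least `c` each, running paths their
  -- current statistic, and the total is at most the accumulated mean growth.
  have hbound : ∀ n, c * M.probInf (S n)ᶜ + ∫⁻ ω in S n, R n ω ∂M.probInf ≤
      (∑ B, w B) * ∑ t ∈ Finset.range n, M.probInf (S t) := by
    intro n
    induction n with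
    | zero =>
      have : S 0 = Set.univ := Set.eq_univ_of_forall fun ω => by simpa [hS] using hT0 ω
      simp [this, hR, shiryaevRoberts]
    | succ n ih =>
      have hsub : S (n + 1) ⊆ S n := fun ω hω =>
        lt_trans (b := ((n + 1 : ℕ) : ℕ∞)) (by exact_mod_cast Nat.lt_succ_self n) hω
      have hcompl : (S (n + 1))ᶜ = (S n)ᶜ ∪ (S n \ S (n + 1)) := by
        ext ω
        have := @hsub ω
        simp only [Set.mem_compl_iff, Set.mem_union, Set.mem_sdiff]
        tauto
      have hjump : c * M.probInf (S n \ S (n + 1)) ≤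
          ∫⁻ ω in S n \ S (n + 1), R (n + 1) ω ∂M.probInf := by
        rw [← setLIntegral_const]
        refine setLIntegral_mono' ((hSm' n).diff (hSm' (n + 1))) fun ω hω => h ω (n + 1) ?_
        have h1 : (n : ℕ∞) < T ω := hω.1
        have h2 : T ω ≤ ((n + 1 : ℕ) : ℕ∞) := not_lt.1 hω.2
        refine le_antisymm h2 ?_
        push_cast
        exact Order.add_one_le_of_lt h1
      have hsplit : ∫⁻ ω in S n \ S (n + 1), R (n + 1) ω ∂M.probInf +
          ∫⁻ ω in S (n + 1), R (n + 1) ω ∂M.probInf = ∫⁻ ω in S n, R (n + 1) ω ∂M.probInf := by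
        rw [← lintegral_union (hSm' (n + 1)) Set.disjoint_sdiff_left, Set.sdiff_union_of_subset hsub]
      calc _ ≤ c * M.probInf (S n)ᶜ + c * M.probInf (S n \ S (n + 1)) +
            ∫⁻ ω in S (n + 1), R (n + 1) ω ∂M.probInf := by
            rw [hcompl, ← mul_add]
            gcongr
            exact measure_union_le _ _
        _ ≤ c * M.probInf (S n)ᶜ + (∫⁻ ω in S n \ S (n + 1), R (n + 1) ω ∂M.probInf +
            ∫⁻ ω in S (n + 1), R (n + 1) ω ∂M.probInf) := by
            rw [add_assoc]
            gcongr
        _ = c * M.probInf (S n)ᶜ + ∫⁻ ω in S n, R n ω ∂M.probInf +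
            (∑ B, w B) * M.probInf (S n) := by rw [hsplit, hstep, add_assoc]
        _ ≤ _ := by
            rw [Finset.sum_range_succ, mul_add]
            gcongr
  rw [lintegral_eq_tsum_measure_lt hT]
  -- An infinite mean makes the claim trivial; a finite one makes `P_∞(T > n)` vanish, and with it
  -- the truncation error.
  by_cases htop : ∑' t, M.probInf (S t) = ∞
  · rw [htop, ENNReal.mul_top hw]; exact le_top
  have hlim := ENNReal.tendsto_atTop_zero_of_tsum_ne_top htop
  have hle : ∀ n, c ≤ (∑ B, w B) * (∑' t, M.probInf (S t)) + c * M.probInf (S n) := fun n =>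
    calc c = c * M.probInf (S n)ᶜ + c * M.probInf (S n) := by
          rw [← mul_add, add_comm, measure_add_measure_compl (hSm' n), measure_univ, mul_one]
      _ ≤ _ := by
          refine add_le_add ((le_self_add.trans (hbound n)).trans ?_) le_rfl
          exact mul_le_mul_right (ENNReal.sum_le_tsum _) _
  have hlim' : Tendsto (fun n => (∑ B, w B) * (∑' t, M.probInf (S t)) + c * M.probInf (S n)) atTop
      (𝓝 ((∑ B, w B) * (∑' t, M.probInf (S t)) + c * 0)) :=
    tendsto_const_nhds.add (ENNReal.Tendsto.const_mul hlim (Or.inr hc))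
  rw [mul_zero, add_zero] at hlim'
  exact ge_of_tendsto' hlim' hle

end FalseAlarm

/-! ### The common form of both rules, its false alarms and its delay. -/

section CrossRule

variable {K : ℕ} {E : Fin K → Type*} [∀ k, MeasurableSpace (E k)]

/-- The statistic `max_{s ≤ t} ∏_k ξ (exp (Z_t^k - Z_s^k))` has reached `c` at time `t`. -/
def Crosses (M : SensorModel E) (ξ : ℝ≥0∞ → ℝ≥0∞) (c : ℝ≥0∞) (t : ℕ) (ω : Path E) : Prop :=
  1 ≤ t ∧ ∃ s ∈ Finset.range (t + 1), c ≤ ∏ k, ξ (∏ u ∈ Finset.Ico s t, M.lr k (ω u k))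

/-- The first time at which `max_{s ≤ t} ∏_k ξ (exp (Z_t^k - Z_s^k))` reaches `c`. -/
noncomputable def crossRule (M : SensorModel E) (ξ : ℝ≥0∞ → ℝ≥0∞) (c : ℝ≥0∞) (ω : Path E) : ℕ∞ :=
  ⨅ (t : ℕ) (_ : M.Crosses ξ c t ω), (t : ℕ∞)

variable {M : SensorModel E} {ξ : ℝ≥0∞ → ℝ≥0∞} {c : ℝ≥0∞}

lemma crossRule_le_iff {t : ℕ} {ω : Path E} :
    M.crossRule ξ c ω ≤ t ↔ ∃ r ≤ t, M.Crosses ξ c r ω := by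
  constructor
  · intro h
    by_contra! hc
    have h1 : ((t + 1 : ℕ) : ℕ∞) ≤ M.crossRule ξ c ω := le_iInf₂ fun r hr => by
      have : t < r := by by_contra hrt; exact hc r (not_lt.1 hrt) hr
      exact_mod_cast this
    have h2 := h1.trans h
    rw [Nat.cast_le] at h2
    omega
  · rintro ⟨r, hr, h⟩
    exact (iInf₂_le r h).trans (by exact_mod_cast hr)

lemma crosses_of_crossRule_eq {t : ℕ} {ω : Path E} (h : M.crossRule ξ c ω = t) :
    M.Crosses ξ c t ω := by
  obtain ⟨r, hr, hcr⟩ := crossRule_le_iff.1 h.le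
  have h1 : M.crossRule ξ c ω ≤ r := crossRule_le_iff.2 ⟨r, le_rfl, hcr⟩
  rw [h, Nat.cast_le] at h1
  rwa [le_antisymm hr h1] at hcr

lemma one_le_crossRule (ω : Path E) : 1 ≤ M.crossRule ξ c ω :=
  le_iInf₂ fun r hr => by exact_mod_cast hr.1

lemma isStoppingTime_crossRule (hξ : Measurable ξ) :
    IsStoppingTime (obsFiltration E) (M.crossRule ξ c) := by
  intro t
  have e : {ω | M.crossRule ξ c ω ≤ (t : WithTop ℕ)} =
      ⋃ r ∈ Finset.Icc 1 t, ⋃ s ∈ Finset.range (r + 1),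
        {ω | c ≤ ∏ k, ξ (∏ u ∈ Finset.Ico s r, M.lr k (ω u k))} := by
    refine Set.ext fun ω => (crossRule_le_iff (t := t)).trans ?_
    simp only [Crosses, Set.mem_iUnion, Finset.mem_Icc, exists_prop]
    exact ⟨fun ⟨r, h1, h2, h3⟩ => ⟨r, ⟨h2, h1⟩, h3⟩, fun ⟨r, ⟨h2, h1⟩, h3⟩ => ⟨r, h1, h2, h3⟩⟩
  refine (congrArg (MeasurableSet[obsFiltration E t]) e).mpr ?_
  refine Finset.measurableSet_biUnion _ fun r hr => Finset.measurableSet_biUnion _ fun s _ => ?_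
  refine measurableSet_le measurable_const (Finset.measurable_fun_prod _ fun k _ => hξ.comp
    (Finset.measurable_fun_prod _ fun u hu => ?_))
  have hut : u < t := (Finset.mem_Ico.1 hu).2.trans_le (Finset.mem_Icc.1 hr).2
  exact (M.measurable_lr k).comp ((measurable_pi_apply k).comp (measurable_obsFiltration_apply hut))

lemma prod_lrProd (A : Finset (Fin K)) (S : Finset ℕ) (ω : Path E) :
    ∏ u ∈ S, M.lrProd A (ω u) = ∏ k ∈ A, ∏ u ∈ S, M.lr k (ω u k) := by
  unfold lrProd
  exact Finset.prod_comm

/-- Settles `γ = 1` separately, where the threshold may be one and the empty window may cross at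
once. -/
lemma crossRule_mem_rulesClass_one (hξ : Measurable ξ) : M.crossRule ξ c ∈ M.rulesClass 1 := by
  refine ⟨isStoppingTime_crossRule hξ, ?_⟩
  calc ENNReal.ofReal 1 = ∫⁻ _, 1 ∂M.probInf := by simp
    _ ≤ _ := lintegral_mono fun ω => by
      have := one_le_crossRule (M := M) (ξ := ξ) (c := c) ω
      simpa using ENat.toENNReal_le.2 this

/-- False alarm bound for a rule whose statistic is dominated by a mixture of likelihood ratios. -/
lemma crossRule_mem_rulesClass (hac : ∀ k, M.postLaw k ≪ M.preLaw k) (hξ : Measurable ξ)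
    (hξ1 : ξ 1 = 1) (w : Finset (Fin K) → ℝ≥0∞) (hw : ∑ B, w B ≠ 0) (hwt : ∑ B, w B ≠ ∞)
    (hc1 : 1 < c) (hct : c ≠ ∞)
    (h : ∀ y : Fin K → ℝ≥0∞, c ≤ ∏ k, ξ (y k) → c ≤ ∑ B, w B * ∏ k ∈ B, y k) {γ : ℝ}
    (hγ : (∑ B, w B) * ENNReal.ofReal γ ≤ c) : M.crossRule ξ c ∈ M.rulesClass γ := by
  have hT := isStoppingTime_crossRule (M := M) (c := c) hξ
  refine ⟨hT, ?_⟩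
  refine (ENNReal.mul_le_mul_iff_right hw hwt).1 (hγ.trans ?_)
  refine le_mul_lintegral_of_le_shiryaevRoberts hac hT
    (fun ω => lt_of_lt_of_le one_pos (one_le_crossRule ω)) w hw hct fun ω t ht => ?_
  obtain ⟨-, s, hs, hcs⟩ := crosses_of_crossRule_eq ht
  rcases (Nat.lt_succ_iff.1 (Finset.mem_range.1 hs)).eq_or_lt with rfl | hst
  · simp only [Finset.Ico_self, Finset.prod_empty, hξ1, Finset.prod_const_one] at hcs
    exact absurd hc1 (not_lt.2 hcs)
  · refine (h _ hcs).trans (Finset.sum_le_sum fun B _ => mul_le_mul_right ?_ _)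
    rw [← prod_lrProd]
    exact prod_lrProd_le_shiryaevRoberts B hst ω

/-- Upper bound on the worst-case delay of a rule whose statistic dominates all likelihood
ratios. -/
lemma exists_delay_crossRule_le (hI : ∀ k, 0 < M.localKL k ∧ M.localKL k ≠ ∞)
    {A : Finset (Fin K)} (hA : A.Nonempty) (h2 : MemLp (M.llrSum A) 2 (M.stepLaw A))
    (hξ : Measurable ξ) {m : ℝ} (hm0 : 0 < m) (hm1 : m ≤ 1)
    (hm : ∀ y, ENNReal.ofReal m ≤ ξ y ∧ ENNReal.ofReal m * y ≤ ξ y) :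
    ∃ C : ℝ, 0 ≤ C ∧ ∀ b : ℝ, 0 ≤ b →
      M.delay A (M.crossRule ξ (ENNReal.ofReal (Real.exp b))) ≤
        ENNReal.ofReal (b / M.info A + C) := by
  have hac : ∀ k, M.postLaw k ≪ M.preLaw k := fun k =>
    (InformationTheory.klDiv_ne_top_iff.1 (hI k).2).1
  obtain ⟨hint, hinfo⟩ := integrable_llrSum (fun k => (hI k).2) A
  have hpos : 0 < M.info A := info_pos hI hA
  have hIpos : 0 < ∫ x, M.llrSum A x ∂(M.stepLaw A) := by rw [hinfo]; exact hpos
  obtain ⟨C, hC, u, hu, hule, hstep⟩ := exists_passage_time_potential (measurable_llrSum A) h2 hIpos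
    (lintegral_exp_neg_half_log_density_lt_one (M.measurable_lrProd A)
      (stepLaw_eq_withDensity hac A) hIpos.ne')
  rw [hinfo] at hule
  -- `-(K * log m)` offsets the factor `m ^ K`; the extra `1` keeps `b + e` positive, as is needed
  -- at `t = 0`, where no crossing is allowed and the empty product is one.
  set e : ℝ := -(K * Real.log m) + 1 with he
  have he0 : 0 < e := by
    have := mul_nonneg (Nat.cast_nonneg K : (0 : ℝ) ≤ K) (neg_nonneg.2 (Real.log_nonpos hm0.le hm1))
    linarith
  refine ⟨e / M.info A + C, by positivity, fun b hb => ?_⟩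
  have hT := isStoppingTime_crossRule (M := M) (c := ENNReal.ofReal (Real.exp b)) hξ
  have hdelay := delay_le_of_potential hac hu hstep hT (c := b + e) fun ω s t hst htT => by
    rcases Nat.eq_zero_or_pos t with rfl | ht
    · obtain rfl : s = 0 := by omega
      simpa using Real.exp_lt_exp.2 (show (0 : ℝ) < b + e by linarith)
    · have hnot : ¬ M.Crosses ξ (ENNReal.ofReal (Real.exp b)) t ω := fun hcr =>
        absurd htT (not_lt.2 (crossRule_le_iff.2 ⟨t, le_rfl, hcr⟩))
      have hlt : ∏ k, ξ (∏ r ∈ Finset.Ico s t, M.lr k (ω r k)) < ENNReal.ofReal (Real.exp b) := by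
        by_contra hge
        exact hnot ⟨ht, s, Finset.mem_range.2 (by omega), not_lt.1 hge⟩
      have hle : ENNReal.ofReal m ^ K * ∏ r ∈ Finset.Ico s t, M.lrProd A (ω r) ≤
          ∏ k, ξ (∏ r ∈ Finset.Ico s t, M.lr k (ω r k)) := by
        have e1 : ENNReal.ofReal m ^ K = ∏ _k : Fin K, ENNReal.ofReal m := by simp
        have e2 : ∏ r ∈ Finset.Ico s t, M.lrProd A (ω r) =
            ∏ k, if k ∈ A then ∏ r ∈ Finset.Ico s t, M.lr k (ω r k) else 1 := by
          rw [prod_lrProd, Finset.prod_ite_mem, Finset.univ_inter]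
        rw [e1, e2, ← Finset.prod_mul_distrib]
        refine Finset.prod_le_prod' fun k _ => ?_
        split_ifs
        · exact (hm _).2
        · rw [mul_one]; exact (hm _).1
      have hmul : ENNReal.ofReal m ^ K * ∏ r ∈ Finset.Ico s t, M.lrProd A (ω r) <
          ENNReal.ofReal m ^ K * ENNReal.ofReal (Real.exp (b + e)) := by
        refine (hle.trans_lt hlt).trans_le ?_
        rw [← ENNReal.ofReal_pow hm0.le, ← ENNReal.ofReal_mul (by positivity)]
        refine ENNReal.ofReal_le_ofReal ?_
        have : m ^ K = Real.exp (K * Real.log m) := by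
          rw [mul_comm, Real.exp_mul, Real.exp_log hm0, Real.rpow_natCast]
        rw [this, ← Real.exp_add]
        exact Real.exp_le_exp.2 (by rw [he]; linarith)
      exact lt_of_mul_lt_mul_left' hmul
  refine hdelay.trans ((hule (b + e)).trans (le_of_eq ?_))
  rw [← ENNReal.ofReal_add (by positivity) hC]
  ring_nf

end CrossRule

/-! ### Calibration of the two thresholds and second-order optimality. -/

section Optimality

variable {K : ℕ} {E : Fin K → Type*} [∀ k, MeasurableSpace (E k)] {M : SensorModel E}

lemma secondOrderOptimal_of_delay_le (hI : ∀ k, 0 < M.localKL k ∧ M.localKL k ≠ ∞)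
    {P : Finset (Finset (Fin K))} (hP : ∀ A ∈ P, A.Nonempty) {T : ℝ → Path E → ℕ∞}
    (hT : ∀ γ : ℝ, 1 ≤ γ → T γ ∈ M.rulesClass γ)
    (hdelay : ∀ A ∈ P, ∃ C : ℝ, 0 ≤ C ∧ ∀ γ : ℝ, 1 ≤ γ →
      M.delay A (T γ) ≤ ENNReal.ofReal (Real.log γ / M.info A + C)) :
    M.SecondOrderOptimal P T := by
  refine ⟨hT, fun A hA => ?_⟩
  obtain ⟨C, hC, hup⟩ := hdelay A hA
  obtain ⟨C', hlow⟩ := le_delay_of_mem_rulesClass hI (hP A hA)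
  have hpos := info_pos hI (hP A hA)
  have hfin : ∀ γ : ℝ, 1 ≤ γ → M.delay A (T γ) ≠ ∞ := fun γ hγ =>
    ((hup γ hγ).trans_lt ENNReal.ofReal_lt_top).ne
  refine ⟨(eventually_ge_atTop 1).mono hfin, ?_⟩
  refine IsBigO.of_bound (C + C') ((eventually_ge_atTop 1).mono fun γ hγ => ?_)
  have hopt : M.optDelay A γ ≤ M.delay A (T γ) := iInf₂_le (T γ) (hT γ hγ)
  have hopt' : M.optDelay A γ ≠ ∞ := (hopt.trans_lt (hfin γ hγ).lt_top).ne
  have h1 : (M.delay A (T γ)).toReal ≤ Real.log γ / M.info A + C :=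
    ENNReal.toReal_le_of_le_ofReal
      (add_nonneg (div_nonneg (Real.log_nonneg hγ) hpos.le) hC) (hup γ hγ)
  have h2 : (M.optDelay A γ).toReal ≤ (M.delay A (T γ)).toReal :=
    ENNReal.toReal_mono (hfin γ hγ) hopt
  have h3 : Real.log γ / M.info A - C' ≤ (M.optDelay A γ).toReal :=
    (ENNReal.ofReal_le_iff_le_toReal hopt').1
      (le_iInf₂ fun T' hT' => hlow γ (by linarith) T' hT')
  rw [Real.norm_of_nonneg (by linarith), norm_one, mul_one]
  linarith

lemma nonempty_of_mem_subsetsAtMost {L : ℕ} {A : Finset (Fin K)} (hA : A ∈ subsetsAtMost K L) :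
    A.Nonempty := by
  simp only [subsetsAtMost, Finset.mem_filter] at hA
  exact Finset.card_pos.1 hA.2.1

lemma mem_subsetsAtMost_self {A : Finset (Fin K)} (hA : A.Nonempty) : A ∈ subsetsAtMost K K := by
  simp only [subsetsAtMost, Finset.mem_filter, Finset.mem_univ, true_and]
  exact ⟨Finset.card_pos.2 hA, by simpa using Finset.card_le_univ A⟩

variable (M)

lemma hatRule_eq_crossRule (p b : ℝ) :
    M.hatRule p b = M.crossRule (fun y => ENNReal.ofReal (1 - p) + ENNReal.ofReal p * y)
      (ENNReal.ofReal (Real.exp b)) := by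
  funext ω
  unfold hatRule crossRule
  have h : ∀ t : ℕ, (1 ≤ t ∧ ENNReal.ofReal (Real.exp b) ≤ M.hatStat p t ω) ↔
      M.Crosses (fun y => ENNReal.ofReal (1 - p) + ENNReal.ofReal p * y)
        (ENNReal.ofReal (Real.exp b)) t ω := fun t => by
    unfold hatStat Crosses
    rw [Finset.le_sup_iff (by simpa using Real.exp_pos b)]
    simp only [exp_incr]
  simp only [h]

lemma checkRule_eq_crossRule (p b : ℝ) :
    M.checkRule p b = M.crossRule (fun y => ENNReal.ofReal (1 - p) + ENNReal.ofReal p * max y 1)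
      (ENNReal.ofReal (Real.exp b)) := by
  funext ω
  unfold checkRule crossRule
  have hlog : ∀ y : Fin K → ℝ≥0∞, ∑ k, ENNReal.log (y k) = ENNReal.log (∏ k, y k) := fun y => by
    induction (Finset.univ : Finset (Fin K)) using Finset.induction_on with
    | empty => simp
    | insert a S ha ih => rw [Finset.sum_insert ha, Finset.prod_insert ha, ENNReal.log_mul_add, ih]
  have hexp : ∀ a : EReal, EReal.exp (max a 0) = max (EReal.exp a) 1 := fun a => by
    rw [EReal.exp_monotone.map_max, EReal.exp_zero]
  have h : ∀ t : ℕ, (1 ≤ t ∧ (b : EReal) ≤ M.checkStat p t ω) ↔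
      M.Crosses (fun y => ENNReal.ofReal (1 - p) + ENNReal.ofReal p * max y 1)
        (ENNReal.ofReal (Real.exp b)) t ω := fun t => by
    unfold checkStat Crosses
    rw [Finset.le_sup_iff (EReal.bot_lt_coe b)]
    have hb : (b : EReal) = ENNReal.log (ENNReal.ofReal (Real.exp b)) := by
      rw [ENNReal.log_ofReal_of_pos (Real.exp_pos b), Real.log_exp]
    simp only [hlog, hexp, exp_incr, hb, ENNReal.log_le_log_iff]
  simp only [h]

variable {M}

lemma ofReal_one_sub_add_ofReal {p : ℝ} (hp : 0 ≤ p) (hp1 : p ≤ 1) :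
    ENNReal.ofReal (1 - p) + ENNReal.ofReal p = 1 := by
  rw [← ENNReal.ofReal_add (by linarith) hp]; simp

/-- The product expands into a sum over all subsets, including the empty one, with binomial weights
of total mass one; hence the threshold `γ` needs no correction. -/
lemma hatRule_mem_rulesClass (hac : ∀ k, M.postLaw k ≪ M.preLaw k) {p : ℝ} (hp : 0 < p)
    (hp1 : p < 1) {γ : ℝ} (hγ : 1 ≤ γ) : M.hatRule p (Real.log γ) ∈ M.rulesClass γ := by
  rw [hatRule_eq_crossRule, Real.exp_log (by linarith)]
  rcases hγ.eq_or_lt with rfl | hγ1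
  · exact crossRule_mem_rulesClass_one (by fun_prop)
  have hone := ofReal_one_sub_add_ofReal hp.le hp1.le
  have hexpand : ∀ y : Fin K → ℝ≥0∞,
      ∏ k, (ENNReal.ofReal (1 - p) + ENNReal.ofReal p * y k) = ∑ B : Finset (Fin K),
        (ENNReal.ofReal p ^ B.card * ENNReal.ofReal (1 - p) ^ (Finset.univ \ B).card) *
          ∏ k ∈ B, y k := fun y => by
    simp_rw [add_comm (ENNReal.ofReal (1 - p))]
    rw [Finset.prod_add, Finset.powerset_univ]
    refine Finset.sum_congr rfl fun B _ => ?_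
    rw [Finset.prod_mul_distrib, Finset.prod_const, Finset.prod_const]
    ring
  have hw : ∑ B : Finset (Fin K),
      ENNReal.ofReal p ^ B.card * ENNReal.ofReal (1 - p) ^ (Finset.univ \ B).card = 1 := by
    have h := hexpand fun _ => 1
    simp only [mul_one, hone, Finset.prod_const_one] at h
    exact h.symm
  refine crossRule_mem_rulesClass hac (by fun_prop) (by simpa using hone)
    (fun B => ENNReal.ofReal p ^ B.card * ENNReal.ofReal (1 - p) ^ (Finset.univ \ B).card)
    (by simp [hw]) (by simp [hw]) (by simpa using hγ1) ENNReal.ofReal_ne_top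
    (fun y hy => hy.trans_eq (hexpand y)) (by rw [hw, one_mul])

lemma card_subsetsAtMost_pos (hK : 1 ≤ K) : 0 < (subsetsAtMost K K).card :=
  Finset.card_pos.2 ⟨{⟨0, hK⟩}, mem_subsetsAtMost_self (Finset.singleton_nonempty _)⟩

/-- The product is at most the likelihood ratio of the sensors with `y k ≥ 1`. Above a threshold
exceeding one this set is nonempty, so the ratio is a term of the unweighted sum over nonempty
subsets, whose total weight is the correction in the threshold. -/
lemma checkRule_mem_rulesClass (hK : 1 ≤ K) (hac : ∀ k, M.postLaw k ≪ M.preLaw k) {p : ℝ}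
    (hp : 0 < p) (hp1 : p ≤ 1) {γ : ℝ} (hγ : 1 ≤ γ) :
    M.checkRule p (Real.log γ + Real.log ((subsetsAtMost K K).card : ℝ)) ∈ M.rulesClass γ := by
  have hcard := card_subsetsAtMost_pos hK
  set n := (subsetsAtMost K K).card with hn
  have hn0 : (0 : ℝ) < n := by exact_mod_cast hcard
  have hn1 : (1 : ℝ) ≤ n := by exact_mod_cast hcard
  rw [checkRule_eq_crossRule, Real.exp_add, Real.exp_log (by linarith), Real.exp_log hn0]
  rcases hγ.eq_or_lt with rfl | hγ1
  · exact crossRule_mem_rulesClass_one (by fun_prop)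
  have hone := ofReal_one_sub_add_ofReal hp.le hp1
  have hw : ∑ B : Finset (Fin K), (if B ∈ subsetsAtMost K K then (1 : ℝ≥0∞) else 0) = n := by
    rw [Finset.sum_ite_mem]; simp [hn]
  have hc1 : 1 < ENNReal.ofReal (γ * n) := by
    rw [← ENNReal.ofReal_one, ENNReal.ofReal_lt_ofReal_iff (by positivity)]
    nlinarith
  refine crossRule_mem_rulesClass hac (by fun_prop) (by simpa using hone)
    (fun B => if B ∈ subsetsAtMost K K then 1 else 0) (by rw [hw]; exact_mod_cast hcard.ne')
    (by rw [hw]; exact ENNReal.natCast_ne_top n) hc1 ENNReal.ofReal_ne_top (fun y hy => ?_) ?_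
  · have h1 : ∏ k, (ENNReal.ofReal (1 - p) + ENNReal.ofReal p * max (y k) 1) ≤
        ∏ k ∈ Finset.univ.filter (fun k => 1 ≤ y k), y k := by
      rw [Finset.prod_filter]
      refine Finset.prod_le_prod' fun k _ => ?_
      have h2 : ENNReal.ofReal (1 - p) + ENNReal.ofReal p * max (y k) 1 ≤ max (y k) 1 := by
        calc _ ≤ ENNReal.ofReal (1 - p) * max (y k) 1 + ENNReal.ofReal p * max (y k) 1 := by
              gcongr
              exact le_mul_of_one_le_right' (le_max_right _ _)
          _ = max (y k) 1 := by rw [← add_mul, hone, one_mul]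
      refine h2.trans (le_of_eq ?_)
      split_ifs with h
      · exact max_eq_left h
      · exact max_eq_right (not_le.1 h).le
    have hne : (Finset.univ.filter fun k => 1 ≤ y k).Nonempty := by
      rw [Finset.nonempty_iff_ne_empty]
      intro he
      rw [he, Finset.prod_empty] at h1
      exact absurd (hc1.trans_le hy) (not_lt.2 h1)
    refine (hy.trans h1).trans ?_
    refine le_trans (le_of_eq ?_) (Finset.single_le_sum
      (f := fun B => (if B ∈ subsetsAtMost K K then (1 : ℝ≥0∞) else 0) * ∏ k ∈ B, y k)
      (fun _ _ => zero_le) (Finset.mem_univ (Finset.univ.filter fun k => 1 ≤ y k)))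
    rw [if_pos (mem_subsetsAtMost_self hne), one_mul]
  · rw [hw, ENNReal.ofReal_mul (by linarith), ENNReal.ofReal_natCast, mul_comm]

end Optimality

end SensorModel

theorem theorem2 {K : ℕ} (hK : 1 ≤ K) {E : Fin K → Type*} [∀ k, MeasurableSpace (E k)]
    (M : SensorModel E) (hI : ∀ k, 0 < M.localKL k ∧ M.localKL k ≠ ∞) :
    ((∀ p : ℝ, 0 < p → p < 1 → ∀ γ : ℝ, 1 ≤ γ →
        M.hatRule p (Real.log γ) ∈ M.rulesClass γ) ∧
      (∀ p : ℝ, 0 < p → p ≤ 1 → ∀ γ : ℝ, 1 ≤ γ →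
        M.checkRule p (Real.log γ + Real.log ((SensorModel.subsetsAtMost K K).card : ℝ)) ∈
          M.rulesClass γ)) ∧
    ((∀ A ∈ SensorModel.subsetsAtMost K K, MemLp (M.firstLLR A) 2 (M.probChange A 0)) →
      (∀ p : ℝ, 0 < p → p < 1 →
        M.SecondOrderOptimal (SensorModel.subsetsAtMost K K)
          fun γ => M.hatRule p (Real.log γ)) ∧
      (∀ p : ℝ, 0 < p → p ≤ 1 →
        M.SecondOrderOptimal (SensorModel.subsetsAtMost K K)
          fun γ => M.checkRule p
            (Real.log γ + Real.log ((SensorModel.subsetsAtMost K K).card : ℝ)))) := by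
  have hac : ∀ k, M.postLaw k ≪ M.preLaw k := fun k =>
    (InformationTheory.klDiv_ne_top_iff.1 (hI k).2).1
  have hhat := fun (p : ℝ) (hp : 0 < p) (hp1 : p < 1) (γ : ℝ) (hγ : 1 ≤ γ) =>
    SensorModel.hatRule_mem_rulesClass hac hp hp1 hγ
  have hcheck := fun (p : ℝ) (hp : 0 < p) (hp1 : p ≤ 1) (γ : ℝ) (hγ : 1 ≤ γ) =>
    SensorModel.checkRule_mem_rulesClass hK hac hp hp1 hγ
  refine ⟨⟨hhat, hcheck⟩, fun hsq => ⟨fun p hp hp1 => ?_, fun p hp hp1 => ?_⟩⟩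
  · refine SensorModel.secondOrderOptimal_of_delay_le hI
      (fun A hA => SensorModel.nonempty_of_mem_subsetsAtMost hA) (hhat p hp hp1) fun A hA => ?_
    obtain ⟨C, hC, h⟩ := SensorModel.exists_delay_crossRule_le (M := M)
      (ξ := fun y => ENNReal.ofReal (1 - p) + ENNReal.ofReal p * y) hI
      (SensorModel.nonempty_of_mem_subsetsAtMost hA)
      (SensorModel.memLp_llrSum (fun k => (hI k).2) (hsq A hA)) (by fun_prop)
      -- The two summands of `ξ` dominate the constant and the linear bound separately, which needs
      -- `p < 1`. In the truncated rule the linear term alone gives both bounds, so `m = p` works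
      -- even for `p = 1`.
      (m := min (1 - p) p) (lt_min (by linarith) hp) ((min_le_right _ _).trans hp1.le)
      fun y => ⟨(ENNReal.ofReal_le_ofReal (min_le_left _ _)).trans le_self_add,
        (mul_le_mul_left (ENNReal.ofReal_le_ofReal (min_le_right _ _)) y).trans le_add_self⟩
    refine ⟨C, hC, fun γ hγ => ?_⟩
    rw [SensorModel.hatRule_eq_crossRule]
    exact h _ (Real.log_nonneg hγ)
  · refine SensorModel.secondOrderOptimal_of_delay_le hI
      (fun A hA => SensorModel.nonempty_of_mem_subsetsAtMost hA) (hcheck p hp hp1) fun A hA => ?_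
    have hA' := SensorModel.nonempty_of_mem_subsetsAtMost hA
    have hone := SensorModel.ofReal_one_sub_add_ofReal hp.le hp1
    obtain ⟨C, hC, h⟩ := SensorModel.exists_delay_crossRule_le (M := M)
      (ξ := fun y => ENNReal.ofReal (1 - p) + ENNReal.ofReal p * max y 1) hI hA'
      (SensorModel.memLp_llrSum (fun k => (hI k).2) (hsq A hA)) (by fun_prop)
      (m := p) hp hp1
      fun y => ⟨(le_mul_of_one_le_right' (le_max_right y 1)).trans le_add_self,
        (mul_le_mul_right (le_max_left y 1) _).trans le_add_self⟩
    have hcard : (1 : ℝ) ≤ ((SensorModel.subsetsAtMost K K).card : ℝ) := by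
      exact_mod_cast SensorModel.card_subsetsAtMost_pos hK
    have hlog := Real.log_nonneg hcard
    have hpos := SensorModel.info_pos hI hA'
    -- The threshold correction does not depend on `γ`, so it costs only a constant delay.
    refine ⟨Real.log ((SensorModel.subsetsAtMost K K).card : ℝ) / M.info A + C, by positivity,
      fun γ hγ => ?_⟩
    rw [SensorModel.checkRule_eq_crossRule, ← add_assoc, ← add_div]
    exact h _ (add_nonneg (Real.log_nonneg hγ) hlog)
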